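/- Let $(M^{\mathrm{out}},g^{\mathrm{out}})$ be a smooth Riemannian manifold of dimension $m+1$ and let $M\subset M^{\mathrm{out}}$ be a (possibly only immersed) smooth hypersurface with induced metric $g$, Levi-Civita connection $\nabla$ and curvature $R$. Let $N$ be a (local) smooth unit normal field, let $\mathrm{II}$ be the second fundamental form, $\nabla^{\mathrm{out}}_XY=\nabla_XY+\mathrm{II}(X,Y)\,N$, also considered as the $TM$-valued $1$-form $X\mapsto\mathrm{II}_X$ with $g(\mathrm{II}_X,Y)=\mathrm{II}(X,Y)$, and put $(\mathrm{II}\wedge N)_XZ:=g^{\mathrm{out}}(\mathrm{II}_X,Z)\,N-g^{\mathrm{out}}(N,Z)\,\mathrm{II}_X$. Denote by $\nabla$ also the direct sum connection on $TM^{\mathrm{out}}|_M=TM\oplus\mathrm{Norm}\,M$ of the Levi-Civita connection and the metric connection of $\mathrm{Norm}\,M$. Suppose that $M$ is permeable, i.e. the $TM$-valued $3$-form $$(R\,\mathrm{II})(X,Y,Z):=R_{X,Y}\mathrm{II}_Z+R_{Y,Z}\mathrm{II}_X+R_{Z,X}\mathrm{II}_Y$$ vanishes identically. Let $F(z)=1+O(z^2)$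 be an even formal power series with complex (for example real) coefficients, let $\log F(z)=\sum_{k>0}f_kz^{2k}$ and $LF(z):=\log F(z)/z^2$. For a connection $\nabla$ on a real vector bundle $VM$ with curvature $R^\nabla$ and an $\mathrm{End}\,VM$-valued $1$-form $\dot\nabla$ define the logarithmic transgression form $$\delta(\log F)(VM,\nabla,\dot\nabla):=\sum_{k>0}k\,f_k\,\mathrm{tr}\Big(\frac{\dot\nabla}{2\pi i}\Big(\frac{R^\nabla}{2\pi i}\Big)^{2k-1}\Big),$$ and for a curve $(\nabla^t)_{0\le t\le1}$ of connections define the transgression form $$\mathrm{trans}\,F:=\int_0^1\exp\Big(\int_0^t d\,\delta(\log F)\big(VM,\nabla^\tau,\tfrac{d}{d\tau}\nabla^\tau\big)\,d\tau\Big)\,\delta(\log F)\big(VM,\nabla^t,\tfrac{d}{dt}\nabla^t\big)\,dt.$$ Let $\xi:=g(d^\nabla\mathrm{II},\mathrm{II})$ be the wedge product of $d^\nabla\mathrm{II}$ and $\mathrm{II}$ contracted with $g$, a $3$-form on $M$. Then the linear interpolation $\nabla^t:=\nabla+t\,\mathrm{II}\wedge N$ connects $\nabla^0=\nabla$ with $\nabla^1=\nabla^{\mathrm{out}}|_M$,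 for all $t\in\mathbb R$ $$\delta(\log F)\big(TM^{\mathrm{out}}|_M,\nabla^t,\mathrm{II}\wedge N\big)=\frac{d}{dt}\Big(\frac{t^2\,\xi}{4\pi^2}\;LF\Big(\sqrt{\tfrac{t^2\,d\xi}{4\pi^2}}\Big)\Big),$$ and the transgression form of the curve $(\nabla^t)_{0\le t\le1}$ equals $$\mathrm{trans}\,F\big(TM^{\mathrm{out}}|_M,\nabla,\nabla+\mathrm{II}\wedge N\big)=\int_0^1F\Big(\sqrt{\tfrac{t^2\,d\xi}{4\pi^2}}\Big)\;\frac{d}{dt}\Big(\frac{t^2\,\xi}{4\pi^2}\;LF\Big(\sqrt{\tfrac{t^2\,d\xi}{4\pi^2}}\Big)\Big)\,dt.$$ All products are taken in the algebra of complex valued differential forms; $F$ and $LF$ are even, so that no square root of $d\xi$ is actually needed, and the series are finite because forms of positive degree are nilpotent. -/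

import Mathlib

open scoped Manifold ContDiff Bundle

noncomputable section

namespace PermeableHypersurface

/-! ## Complex valued differential forms in coordinates `x¹, …, xᵐ` -/

/-- Coordinate space. -/
abbrev Coord (n : ℕ) := EuclideanSpace ℝ (Fin n)

/-- The values of complex valued differential forms of arbitrary degree in coordinates
`x¹, …, xᵐ`: the exterior algebra on the symbols `dx¹, …, dxᵐ`. The wedge product is the
multiplication of this algebra. A differential form is a function `Coord m → Forms m`. -/
abbrev Forms (m : ℕ) := ExteriorAlgebra ℂ (Fin m → ℂ)

/-- The coordinate differential `dxⁱ`. -/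
def dx {m : ℕ} (i : Fin m) : Forms m := ExteriorAlgebra.ι ℂ (Pi.single i (1 : ℂ))

/-- The basis of the products `dx^{i₁} ∧ … ∧ dx^{iₚ}` with `i₁ < … < iₚ`. -/
def formBasis (m : ℕ) : Module.Basis (Finset (Fin m)) ℂ (Forms m) :=
  (Pi.basisFun ℂ (Fin m)).ExteriorAlgebra

/-- The coefficient of a form at `dx^{i₁} ∧ … ∧ dx^{iₚ}` for `s = {i₁ < … < iₚ}`. -/
def formCoeff {m : ℕ} (s : Finset (Fin m)) : Forms m →ₗ[ℂ] ℂ := (formBasis m).coord s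

/-- Partial derivative `∂ᵢ u` of a real function of `n` coordinates. -/
def pd {n : ℕ} (i : Fin n) (u : Coord n → ℝ) (x : Coord n) : ℝ :=
  fderiv ℝ u x (EuclideanSpace.single i 1)

/-- Exterior derivative `d(∑ η_s dx^s) = ∑ ∂ᵢ η_s dxⁱ ∧ dx^s`. -/
def extD {m : ℕ} (η : Coord m → Forms m) (x : Coord m) : Forms m :=
  ∑ s : Finset (Fin m), ∑ i : Fin m,
    (fderiv ℝ (fun y => formCoeff s (η y)) x (EuclideanSpace.single i 1)) •
      (dx i * formBasis m s)

/-- `c' = (d/dt) c (t)` for a curve of forms at a fixed point (coefficient by coefficient). -/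
def HasTimeDerivAt {m : ℕ} (c : ℝ → Forms m) (c' : Forms m) (t : ℝ) : Prop :=
  ∀ s : Finset (Fin m), HasDerivAt (fun τ => formCoeff s (c τ)) (formCoeff s c') t

/-- The derivative `(d/dt) c (t)` of a curve of forms at a fixed point. -/
def timeDeriv {m : ℕ} (c : ℝ → Forms m) (t : ℝ) : Forms m :=
  ∑ s : Finset (Fin m), deriv (fun τ => formCoeff s (c τ)) t • formBasis m s

/-- The integral `∫_a^b c(τ) dτ` of a curve of forms at a fixed point. -/
def timeIntegral {m : ℕ} (c : ℝ → Forms m) (a b : ℝ) : Forms m :=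
  ∑ s : Finset (Fin m), (∫ τ in a..b, formCoeff s (c τ)) • formBasis m s

/-- The value `∑ₖ aₖ ηᵏ` of the power series `∑ₖ aₖ zᵏ` at a form `η` without constant term;
all powers of such an `η` beyond the `m`-th one vanish. -/
def evalSeries {m : ℕ} (F : PowerSeries ℂ) (η : Forms m) : Forms m :=
  ∑ k ∈ Finset.range (m + 1), PowerSeries.coeff k F • η ^ k

/-- The value `F(√η) = ∑ₖ F₂ₖ ηᵏ` of an even power series `F(z) = ∑ₖ F₂ₖ z²ᵏ` at the square root
of a form `η` without constant term. -/
def evalSqrt {m : ℕ} (F : PowerSeries ℂ) (η : Forms m) : Forms m :=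
  ∑ k ∈ Finset.range (m + 1), PowerSeries.coeff (2 * k) F • η ^ k

/-! ## Connections and transgression forms -/

/-- `F(z) = 1 + O(z²)` is an even formal power series. -/
def IsEvenUnitSeries (F : PowerSeries ℂ) : Prop :=
  PowerSeries.constantCoeff F = 1 ∧ ∀ n : ℕ, Odd n → PowerSeries.coeff n F = 0

/-- The power series `LF(z) = log F(z) / z²`. -/
def LF (F : PowerSeries ℂ) : PowerSeries ℂ :=
  PowerSeries.mk fun n => PowerSeries.coeff (n + 2) (PowerSeries.logOf F)

/-- The curvature `R = dA + A ∧ A` of the connection `∇ = d + A` given with respect to a local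
frame of a vector bundle by the matrix `A` of `1`-forms (`∇ e_b = ∑ₐ A_{ab} eₐ`). -/
def curvature {m : ℕ} {κ : Type*} [Fintype κ] (A : Coord m → Matrix κ κ (Forms m))
    (x : Coord m) : Matrix κ κ (Forms m) :=
  Matrix.of (fun a b => extD (fun y => A y a b) x) + A x * A x

/-- The logarithmic transgression form
`δ(log F)(∇, ∇̇) = ∑_{k>0} k fₖ tr((∇̇/2πi) (R/2πi)^{2k-1})`, `log F(z) = ∑_{k>0} fₖ z²ᵏ`, of a
connection `∇ = d + A` and a variation `∇̇ = B`. The `k`-th summand has degree `4k - 1` and thus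
vanishes for `k > m`. -/
def logTransgression {m : ℕ} {κ : Type*} [Fintype κ] [DecidableEq κ] (F : PowerSeries ℂ)
    (A B : Coord m → Matrix κ κ (Forms m)) (x : Coord m) : Forms m :=
  ∑ k ∈ Finset.Icc 1 m, ((k : ℂ) * PowerSeries.coeff (2 * k) (PowerSeries.logOf F)) •
    Matrix.trace (((2 * (Real.pi : ℂ) * Complex.I)⁻¹ • B x) *
      ((2 * (Real.pi : ℂ) * Complex.I)⁻¹ • curvature A x) ^ (2 * k - 1))

/-- The velocity `d/dt ∇ᵗ` of a curve `∇ᵗ = d + Aᵗ` of connections. -/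
def connVelocity {m : ℕ} {κ : Type*} (A : ℝ → Coord m → Matrix κ κ (Forms m)) (t : ℝ)
    (x : Coord m) : Matrix κ κ (Forms m) :=
  Matrix.of fun a b => timeDeriv (fun τ => A τ x a b) t

/-- The transgression form
`trans F = ∫₀¹ exp(∫₀ᵗ d δ(log F)(∇^τ, d/dτ ∇^τ) dτ) ∧ δ(log F)(∇ᵗ, d/dt ∇ᵗ) dt`
of a curve `∇ᵗ = d + Aᵗ`, `0 ≤ t ≤ 1`, of connections. -/
def transgression {m : ℕ} {κ : Type*} [Fintype κ] [DecidableEq κ] (F : PowerSeries ℂ)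
    (A : ℝ → Coord m → Matrix κ κ (Forms m)) (x : Coord m) : Forms m :=
  timeIntegral (fun t =>
    evalSeries (PowerSeries.exp ℂ)
      (timeIntegral (fun τ => extD (logTransgression F (A τ) (connVelocity A τ)) x) 0 t) *
    logTransgression F (A t) (connVelocity A t) x) 0 1

/-! ## Riemannian geometry of a hypersurface in coordinates -/

/-- Christoffel symbols `Γᶜ_{ab} = ½ ∑_d G^{cd} (∂ₐ G_{bd} + ∂_b G_{ad} - ∂_d G_{ab})` of the
Levi-Civita connection of the metric `G`. -/
def christoffel {n : ℕ} (G : Coord n → Matrix (Fin n) (Fin n) ℝ) (y : Coord n)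
    (c a b : Fin n) : ℝ :=
  1 / 2 * ∑ d, (G y)⁻¹ c d *
    (pd a (fun z => G z b d) y + pd b (fun z => G z a d) y - pd d (fun z => G z a b) y)

/-- Coordinate expression of a hypersurface with unit normal field: the metric `G` of the outer
manifold, the inclusion `f` and the components of the normal field `N` along `f`. -/
structure Patch (m : ℕ) where
  G : Coord (m + 1) → Matrix (Fin (m + 1)) (Fin (m + 1)) ℝ
  f : Coord m → Coord (m + 1)
  N : Coord m → Fin (m + 1) → ℝ

namespace Patch

variable {m : ℕ} (P : Patch m)

/-- The components of the tangent vector field `∂ᵢ f`. -/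
def tangent (i : Fin m) (x : Coord m) (c : Fin (m + 1)) : ℝ := pd i (fun y => P.f y c) x

/-- The induced metric `g_{ij} = g^out(∂ᵢ f, ∂ⱼ f)`. -/
def metric (x : Coord m) : Matrix (Fin m) (Fin m) ℝ :=
  Matrix.of fun i j => ∑ a, ∑ b, P.G (P.f x) a b * P.tangent i x a * P.tangent j x b

/-- The restricted Levi-Civita connection of the outer manifold: the components of
`∇^out_{∂ᵢ} s` for a section `s` of `TM^out|_M`. -/
def covOut (i : Fin m) (s : Coord m → Fin (m + 1) → ℝ) (x : Coord m) (c : Fin (m + 1)) : ℝ :=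
  pd i (fun y => s y c) x +
    ∑ a, ∑ b, christoffel P.G (P.f x) c a b * P.tangent i x a * s x b

/-- The second fundamental form `II(∂ᵢ, ∂ⱼ) = g^out(∇^out_{∂ᵢ} ∂ⱼ f, N)`. -/
def secondFF (x : Coord m) (i j : Fin m) : ℝ :=
  ∑ a, ∑ b, P.G (P.f x) a b * P.covOut i (P.tangent j) x a * P.N x b

/-- The Weingarten map: `II_{∂ᵢ} = ∑ₖ IIᵏᵢ ∂ₖ` with `g(II_X, Y) = II(X, Y)`. -/
def weingarten (x : Coord m) (k i : Fin m) : ℝ :=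
  ∑ j, (P.metric x)⁻¹ k j * P.secondFF x i j

/-- The components `IIᵏ` of the second fundamental form as a vector valued `1`-form. -/
def vecII (x : Coord m) (k : Fin m) : Forms m := ∑ i, (P.weingarten x k i : ℂ) • dx i

/-- The `1`-forms `g(II, ∂ⱼ)`. -/
def covecII (x : Coord m) (j : Fin m) : Forms m := ∑ i, (P.secondFF x i j : ℂ) • dx i

/-- The connection matrix of the Levi-Civita connection of the induced metric in the frame
`∂₁, …, ∂ₘ` of `TM`. -/
def leviCivita (x : Coord m) : Matrix (Fin m) (Fin m) (Forms m) :=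
  Matrix.of fun k j => ∑ i, (christoffel P.metric x k i j : ℂ) • dx i

/-- The components of the covariant exterior derivative `d^∇ II`, a vector valued `2`-form. -/
def dII (x : Coord m) (k : Fin m) : Forms m :=
  extD (fun y => P.vecII y k) x + ∑ j, P.leviCivita x k j * P.vecII x j

/-- The components of the vector valued `3`-form
`(R II)(X, Y, Z) = R_{X,Y} II_Z + R_{Y,Z} II_X + R_{Z,X} II_Y`. -/
def curvII (x : Coord m) (k : Fin m) : Forms m :=
  ∑ j, curvature P.leviCivita x k j * P.vecII x j

/-- The `3`-form `ξ = g(d^∇ II, II)`. -/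
def xi (x : Coord m) : Forms m :=
  ∑ k, ∑ l, (P.metric x k l : ℂ) • (P.dII x k * P.vecII x l)

/-- The frame `∂₁ f, …, ∂ₘ f, N` of `TM^out|_M = TM ⊕ Norm M`. -/
def frame : Fin m ⊕ Unit → Coord m → Fin (m + 1) → ℝ
  | Sum.inl j => P.tangent j
  | Sum.inr _ => P.N

/-- The connection matrix, in the frame `∂₁ f, …, ∂ₘ f, N`, of the direct sum `∇` of the
Levi-Civita connection of `M` and the metric connection of `Norm M`, for which the unit normal
field `N` is parallel. -/
def nabla (x : Coord m) : Matrix (Fin m ⊕ Unit) (Fin m ⊕ Unit) (Forms m) :=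
  Matrix.fromBlocks (P.leviCivita x) 0 0 0

/-- The matrix, in the frame `∂₁ f, …, ∂ₘ f, N`, of the endomorphism valued `1`-form
`(II ∧ N)_X Z = g^out(II_X, Z) N - g^out(N, Z) II_X`. -/
def wedgeN (x : Coord m) : Matrix (Fin m ⊕ Unit) (Fin m ⊕ Unit) (Forms m) :=
  Matrix.fromBlocks 0 (Matrix.of fun k _ => -P.vecII x k) (Matrix.of fun _ j => P.covecII x j) 0

/-- The linear interpolation `∇ᵗ = ∇ + t II ∧ N`. -/
def nablaT (t : ℝ) (x : Coord m) : Matrix (Fin m ⊕ Unit) (Fin m ⊕ Unit) (Forms m) :=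
  P.nabla x + (t : ℂ) • P.wedgeN x

/-- At the point `x` the restricted connection `∇^out|_M` has the connection matrix `A` in the
frame `e = (∂₁ f, …, ∂ₘ f, N)`, i.e. `∇^out e_β = ∑_α A_{αβ} e_α`. -/
def IsOuterConnectionMatrix (A : Matrix (Fin m ⊕ Unit) (Fin m ⊕ Unit) (Forms m))
    (x : Coord m) : Prop :=
  ∀ (β : Fin m ⊕ Unit) (c : Fin (m + 1)),
    ∑ i, (P.covOut i (P.frame β) x c : ℂ) • dx i = ∑ α, (P.frame α x c : ℂ) • A α β

end Patch

/-! ## Hypersurfaces of Riemannian manifolds -/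

section Manifold

variable {m : ℕ}
  {M : Type*} [TopologicalSpace M] [ChartedSpace (EuclideanSpace ℝ (Fin m)) M]
  {M' : Type*} [TopologicalSpace M'] [ChartedSpace (EuclideanSpace ℝ (Fin (m + 1))) M']
  [IsManifold (𝓡 (m + 1)) ∞ M']

/-- `ι : M → M'` is a smooth immersion of a manifold of dimension `m` as a hypersurface. -/
def IsHypersurface (ι : M → M') : Prop :=
  ContMDiff (𝓡 m) (𝓡 (m + 1)) ∞ ι ∧
    ∀ p : M, Function.Injective (mfderiv (𝓡 m) (𝓡 (m + 1)) ι p)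

/-- `N` is a smooth unit normal field of the hypersurface `ι : M → M'` on `U ⊆ M`. -/
def IsUnitNormal
    (g : Bundle.ContMDiffRiemannianMetric (𝓡 (m + 1)) ∞ (EuclideanSpace ℝ (Fin (m + 1)))
      (fun q : M' => TangentSpace (𝓡 (m + 1)) q))
    (ι : M → M') (U : Set M) (N : ∀ p : M, TangentSpace (𝓡 (m + 1)) (ι p)) : Prop :=
  ContMDiffOn (𝓡 m) (𝓡 (m + 1)).tangent ∞
      (fun p => (⟨ι p, N p⟩ : TangentBundle (𝓡 (m + 1)) M')) U ∧
    ∀ p ∈ U, g.inner (ι p) (N p) (N p) = 1 ∧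
      ∀ v : TangentSpace (𝓡 m) p,
        g.inner (ι p) (mfderiv (𝓡 m) (𝓡 (m + 1)) ι p v) (N p) = 0

/-- The coordinate expression of a hypersurface with normal field `N` in a chart `φ` of `M` and
a chart `ψ` of the outer manifold. -/
def patch
    (g : Bundle.ContMDiffRiemannianMetric (𝓡 (m + 1)) ∞ (EuclideanSpace ℝ (Fin (m + 1)))
      (fun q : M' => TangentSpace (𝓡 (m + 1)) q))
    (ι : M → M') (N : ∀ p : M, TangentSpace (𝓡 (m + 1)) (ι p))
    (φ : OpenPartialHomeomorph M (EuclideanSpace ℝ (Fin m)))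
    (ψ : OpenPartialHomeomorph M' (EuclideanSpace ℝ (Fin (m + 1)))) : Patch m where
  G := fun y => Matrix.of fun a b =>
    g.inner (ψ.symm y)
      (mfderiv (𝓡 (m + 1)) (𝓡 (m + 1)) ψ.symm y (EuclideanSpace.single a (1 : ℝ)))
      (mfderiv (𝓡 (m + 1)) (𝓡 (m + 1)) ψ.symm y (EuclideanSpace.single b (1 : ℝ)))
  f := fun x => ψ (ι (φ.symm x))
  N := fun x c =>
    (show EuclideanSpace ℝ (Fin (m + 1)) from
      mfderiv (𝓡 (m + 1)) (𝓡 (m + 1)) ψ (ι (φ.symm x)) (N (φ.symm x))) c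

/-- The points `x` in the range of the chart `φ` at which the coordinate expression in the charts
`φ` and `ψ` of a hypersurface with normal field defined on `U` makes sense. -/
def patchDomain (ι : M → M') (U : Set M)
    (φ : OpenPartialHomeomorph M (EuclideanSpace ℝ (Fin m)))
    (ψ : OpenPartialHomeomorph M' (EuclideanSpace ℝ (Fin (m + 1)))) :
    Set (EuclideanSpace ℝ (Fin m)) :=
  {x | x ∈ φ.target ∧ φ.symm x ∈ U ∧ ι (φ.symm x) ∈ ψ.source}

/-- The hypersurface `ι : M → M'` is permeable: the vector valued `3`-form `R II` vanishes
identically, where `II` is taken with respect to local unit normal fields. -/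
def IsPermeable
    (g : Bundle.ContMDiffRiemannianMetric (𝓡 (m + 1)) ∞ (EuclideanSpace ℝ (Fin (m + 1)))
      (fun q : M' => TangentSpace (𝓡 (m + 1)) q))
    (ι : M → M') : Prop :=
  ∀ (U : Set M) (N : ∀ p : M, TangentSpace (𝓡 (m + 1)) (ι p)),
    IsOpen U → IsUnitNormal g ι U N →
    ∀ φ ∈ IsManifold.maximalAtlas (𝓡 m) ∞ M,
    ∀ ψ ∈ IsManifold.maximalAtlas (𝓡 (m + 1)) ∞ M',
    ∀ x ∈ patchDomain ι U φ ψ, ∀ k : Fin m, (patch g ι N φ ψ).curvII x k = 0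

end Manifold

end PermeableHypersurface

end

noncomputable section

namespace PermeableHypersurface

set_option linter.unusedSectionVars false

/-! Everything is computed in charts, with connection matrices in the frame `∂₁ f, …, ∂ₘ f, N`. The
Gauss and Weingarten formulas say that the outer connection has matrix `∇ + II ∧ N` there
(`isOuterConnectionMatrix`).

Write `v` for `II` as a column, `b = g(II, ·)` as a row, and `w = d^∇ v`, `c = d^∇ b`. The curvature
of `∇ᵗ` has the blocks `R - t² v b`, `-t w`, `t c` and `-t² b v = 0` (`curvature_nablaT`).
Permeability is `R v = 0`; differentiating it with the Bianchi identity gives `R w = 0`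
(`curvature_mul_colDII`). Since `g` is parallel, `b w = c v = ξ`. Moreover `d^∇ c = -b R`, so
permeability also gives `c w = dξ` (`extD_xi`). Finally `ξ² = 0`, because `ξ` has odd degree.

These relations make the powers of the curvature matrix computable. Applied to the column `(0, 1)`,
each two steps multiply the normal entry by `-t² dξ`, and the extra tangential term `t³ v ξ` is
killed by the next step. Hence `tr((II ∧ N) (Rᵗ)^(2k+1)) = -2t ξ (-t² dξ)^k`
(`trace_velBlock_mul_curvBlock_pow`). The powers of `2πi` cancel the signs, and summation with the
weights `k fₖ` produces the derivative of `(t² ξ / 4π²) LF(√(t² dξ / 4π²))`.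

As `d(ξ (dξ)^k) = (dξ)^(k+1)`, the inner integral of the transgression form is `log F(√(t² dξ /
4π²))`. Its exponential is `F(√(t² dξ / 4π²))`; this is an identity of formal power series
(`exp_subst_evenPart_logOf`) evaluated at a nilpotent form (`sum_exp_log`). -/

/-- Regularity of a coordinate expression of a hypersurface on an open set `W` of parameters whose
image lies in the open set `V`: smoothness, positivity of the metric, linear independence of the
tangent vectors and the defining properties of the unit normal field. -/
structure Patch.IsRegularOn {m : ℕ} (P : Patch m) (W : Set (Coord m)) (V : Set (Coord (m + 1))) :
    Prop where
  isOpen_left : IsOpen W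
  isOpen_right : IsOpen V
  mapsTo : ∀ x ∈ W, P.f x ∈ V
  smooth_G : ∀ a b, ContDiffOn ℝ ∞ (fun y => P.G y a b) V
  smooth_f : ContDiffOn ℝ ∞ P.f W
  smooth_N : ∀ c, ContDiffOn ℝ ∞ (fun x => P.N x c) W
  symm : ∀ y a b, P.G y a b = P.G y b a
  pos : ∀ y ∈ V, ∀ u : Fin (m + 1) → ℝ, u ≠ 0 → 0 < ∑ a, ∑ b, P.G y a b * u a * u b
  unit : ∀ x ∈ W, ∑ a, ∑ b, P.G (P.f x) a b * P.N x a * P.N x b = 1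
  orth : ∀ x ∈ W, ∀ i, ∑ a, ∑ b, P.G (P.f x) a b * P.tangent i x a * P.N x b = 0
  indep : ∀ x ∈ W, LinearIndependent ℝ (fun i => P.tangent i x)

/-! ### Differentials of charts and of their inverses -/

section Chart

variable {n : ℕ} {M : Type*} [TopologicalSpace M] [ChartedSpace (EuclideanSpace ℝ (Fin n)) M]
  {ψ : OpenPartialHomeomorph M (EuclideanSpace ℝ (Fin n))}

theorem mdifferentiableAt_chart (hψ : ψ ∈ IsManifold.maximalAtlas (𝓡 n) ∞ M) {q : M}
    (hq : q ∈ ψ.source) : MDifferentiableAt (𝓡 n) (𝓡 n) ψ q :=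
  (contMDiffAt_of_mem_maximalAtlas hψ hq).mdifferentiableAt (by simp)

theorem mdifferentiableAt_chart_symm (hψ : ψ ∈ IsManifold.maximalAtlas (𝓡 n) ∞ M)
    {y : EuclideanSpace ℝ (Fin n)} (hy : y ∈ ψ.target) :
    MDifferentiableAt (𝓡 n) (𝓡 n) ψ.symm y :=
  (contMDiffAt_symm_of_mem_maximalAtlas hψ hy).mdifferentiableAt (by simp)

/-- Chain rule for `ψ.symm ∘ ψ`, which is the identity near `q`. The ascription is needed because
the result lives in the tangent space at `ψ.symm (ψ q)`, which agrees with the one at `q` only after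
unfolding to the model space. -/
theorem mfderiv_chart_symm_mfderiv_chart (hψ : ψ ∈ IsManifold.maximalAtlas (𝓡 n) ∞ M) {q : M}
    (hq : q ∈ ψ.source) (v : EuclideanSpace ℝ (Fin n)) :
    (show EuclideanSpace ℝ (Fin n) from
      mfderiv (𝓡 n) (𝓡 n) ψ.symm (ψ q) (mfderiv (𝓡 n) (𝓡 n) ψ q v)) = v := by
  have h1 := mfderiv_comp q (mdifferentiableAt_chart_symm hψ (ψ.map_source hq))
    (mdifferentiableAt_chart hψ hq)
  have h2 : (ψ.symm ∘ ψ) =ᶠ[nhds q] id :=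
    (ψ.open_source.mem_nhds hq |> Filter.eventually_of_mem <| fun y hy => ψ.left_inv hy)
  have h3 := h2.mfderiv_eq (I := 𝓡 n) (I' := 𝓡 n)
  rw [mfderiv_id] at h3
  exact congrArg (fun L : EuclideanSpace ℝ (Fin n) →L[ℝ] EuclideanSpace ℝ (Fin n) => L v)
    (h1.symm.trans h3)

theorem mfderiv_chart_mfderiv_chart_symm (hψ : ψ ∈ IsManifold.maximalAtlas (𝓡 n) ∞ M)
    {y : EuclideanSpace ℝ (Fin n)} (hy : y ∈ ψ.target) (v : EuclideanSpace ℝ (Fin n)) :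
    (show EuclideanSpace ℝ (Fin n) from
      mfderiv (𝓡 n) (𝓡 n) ψ (ψ.symm y) (mfderiv (𝓡 n) (𝓡 n) ψ.symm y v)) = v := by
  have h1 := mfderiv_comp y (mdifferentiableAt_chart hψ (ψ.map_target hy))
    (mdifferentiableAt_chart_symm hψ hy)
  have h2 : (ψ ∘ ψ.symm) =ᶠ[nhds y] id :=
    (ψ.open_target.mem_nhds hy |> Filter.eventually_of_mem <| fun y hy => ψ.right_inv hy)
  have h3 := h2.mfderiv_eq (I := 𝓡 n) (I' := 𝓡 n)
  rw [mfderiv_id] at h3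
  exact congrArg (fun L : EuclideanSpace ℝ (Fin n) →L[ℝ] EuclideanSpace ℝ (Fin n) => L v)
    (h1.symm.trans h3)

end Chart

theorem euclidean_eq_sum_single {n : ℕ} (u : EuclideanSpace ℝ (Fin n)) :
    u = ∑ a, u a • EuclideanSpace.single a (1 : ℝ) := by
  ext c
  simp [Pi.single_apply]

/-! ### Regularity of the coordinate expression of a hypersurface -/

section Metric

variable {m : ℕ}
  {M : Type*} [TopologicalSpace M] [ChartedSpace (EuclideanSpace ℝ (Fin m)) M]
  [IsManifold (𝓡 m) ∞ M]
  {M' : Type*} [TopologicalSpace M'] [ChartedSpace (EuclideanSpace ℝ (Fin (m + 1))) M']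
  [IsManifold (𝓡 (m + 1)) ∞ M']
  (g : Bundle.ContMDiffRiemannianMetric (𝓡 (m + 1)) ∞ (EuclideanSpace ℝ (Fin (m + 1)))
      (fun q : M' => TangentSpace (𝓡 (m + 1)) q))
  {ι : M → M'} {U : Set M} {N : ∀ p : M, TangentSpace (𝓡 (m + 1)) (ι p)}
  {φ : OpenPartialHomeomorph M (EuclideanSpace ℝ (Fin m))}
  {ψ : OpenPartialHomeomorph M' (EuclideanSpace ℝ (Fin (m + 1)))}

theorem patch_sum_G (y u w : EuclideanSpace ℝ (Fin (m + 1))) :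
    ∑ a, ∑ b, (patch g ι N φ ψ).G y a b * u a * w b =
      g.inner (ψ.symm y) (mfderiv (𝓡 (m + 1)) (𝓡 (m + 1)) ψ.symm y u)
        (mfderiv (𝓡 (m + 1)) (𝓡 (m + 1)) ψ.symm y w) := by
  conv_rhs => rw [euclidean_eq_sum_single u, euclidean_eq_sum_single w]
  -- Bilinear expansion over an abstract space `T`, so that the dependent tangent space type does
  -- not obstruct rewriting.
  have key : ∀ (T : Type) [AddCommGroup T] [Module ℝ T] [TopologicalSpace T]
      (B : T →L[ℝ] T →L[ℝ] ℝ)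
      (L : EuclideanSpace ℝ (Fin (m + 1)) →L[ℝ] T),
      B (L (∑ a, u a • EuclideanSpace.single a (1 : ℝ)))
        (L (∑ a, w a • EuclideanSpace.single a (1 : ℝ))) =
      ∑ a, ∑ b, B (L (EuclideanSpace.single a 1)) (L (EuclideanSpace.single b 1)) *
        u a * w b := by
    intro T _ _ _ B L
    simp only [map_sum, map_smul, sum_apply, smul_apply,
      smul_eq_mul, Finset.mul_sum]
    refine Finset.sum_comm.trans (Finset.sum_congr rfl fun a _ => Finset.sum_congr rfl fun b _ => ?_)
    ring
  exact (key (TangentSpace (𝓡 (m + 1)) (ψ.symm y)) (g.inner (ψ.symm y))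
    (mfderiv (𝓡 (m + 1)) (𝓡 (m + 1)) ψ.symm y)).symm

/-- Transports the metric along an equality of base points such as `ψ.symm (ψ q) = q`; the vectors
are kept in the common model space. -/
theorem inner_congr_point {q q' : M'} (h : q' = q) (v w : EuclideanSpace ℝ (Fin (m + 1))) :
    g.inner q' (show TangentSpace (𝓡 (m + 1)) q' from v) (show TangentSpace (𝓡 (m + 1)) q' from w)
    = g.inner q (show TangentSpace (𝓡 (m + 1)) q from v)
      (show TangentSpace (𝓡 (m + 1)) q from w) := by
  subst h; rfl

theorem patch_sum_G_mfderiv (hψ : ψ ∈ IsManifold.maximalAtlas (𝓡 (m + 1)) ∞ M') {q : M'}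
    (hq : q ∈ ψ.source) (v w : TangentSpace (𝓡 (m + 1)) q) :
    ∑ a, ∑ b, (patch g ι N φ ψ).G (ψ q) a b *
      (show EuclideanSpace ℝ (Fin (m + 1)) from mfderiv (𝓡 (m + 1)) (𝓡 (m + 1)) ψ q v) a *
      (show EuclideanSpace ℝ (Fin (m + 1)) from mfderiv (𝓡 (m + 1)) (𝓡 (m + 1)) ψ q w) b =
      g.inner q v w := by
  rw [patch_sum_G]
  have hv := mfderiv_chart_symm_mfderiv_chart hψ hq v
  have hw := mfderiv_chart_symm_mfderiv_chart hψ hq w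
  refine Eq.trans ?_ (inner_congr_point g (ψ.left_inv hq) v w)
  exact congrArg₂ (fun v w : EuclideanSpace ℝ (Fin (m + 1)) => g.inner (ψ.symm (ψ q)) v w) hv hw

theorem isOpen_patchDomain (hι : IsHypersurface (m := m) ι) (hU : IsOpen U) :
    IsOpen (patchDomain ι U φ ψ) := by
  have h1 : IsOpen (U ∩ ι ⁻¹' ψ.source) := hU.inter (ψ.open_source.preimage hι.1.continuous)
  have h2 := φ.symm.isOpen_inter_preimage h1
  exact h2

theorem patch_contDiffOn_f (hι : IsHypersurface (m := m) ι)
    (hφ : φ ∈ IsManifold.maximalAtlas (𝓡 m) ∞ M)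
    (hψ : ψ ∈ IsManifold.maximalAtlas (𝓡 (m + 1)) ∞ M') :
    ContDiffOn ℝ ∞ (patch g ι N φ ψ).f (patchDomain ι U φ ψ) := by
  rw [← contMDiffOn_iff_contDiffOn]
  intro x hx
  have h1 : ContMDiffAt (𝓡 m) (𝓡 m) ∞ φ.symm x := contMDiffAt_symm_of_mem_maximalAtlas hφ hx.1
  have h2 : ContMDiffAt (𝓡 m) (𝓡 (m + 1)) ∞ ι (φ.symm x) := hι.1 _
  have h3 : ContMDiffAt (𝓡 (m + 1)) (𝓡 (m + 1)) ∞ ψ (ι (φ.symm x)) :=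
    contMDiffAt_of_mem_maximalAtlas hψ hx.2.2
  exact (h3.comp x (h2.comp x h1)).contMDiffWithinAt

theorem patch_tangent (hι : IsHypersurface (m := m) ι) (hφ : φ ∈ IsManifold.maximalAtlas (𝓡 m) ∞ M)
    (hψ : ψ ∈ IsManifold.maximalAtlas (𝓡 (m + 1)) ∞ M')
    {x : EuclideanSpace ℝ (Fin m)} (hx : x ∈ patchDomain ι U φ ψ) (i : Fin m) (c : Fin (m + 1)) :
    (patch g ι N φ ψ).tangent i x c =
      (show EuclideanSpace ℝ (Fin (m + 1)) from
        mfderiv (𝓡 (m + 1)) (𝓡 (m + 1)) ψ (ι (φ.symm x)) (mfderiv (𝓡 m) (𝓡 (m + 1)) ι (φ.symm x)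
          (mfderiv (𝓡 m) (𝓡 m) φ.symm x (EuclideanSpace.single i (1 : ℝ))))) c := by
  have h1 := mdifferentiableAt_chart_symm hφ hx.1
  have h2 : MDifferentiableAt (𝓡 m) (𝓡 (m + 1)) ι (φ.symm x) :=
    (hι.1 _).mdifferentiableAt (by simp)
  have h3 := mdifferentiableAt_chart hψ hx.2.2
  have e1 := mfderiv_comp x h3 (h2.comp x h1)
  have e2 := mfderiv_comp x h2 h1
  have e3 : mfderiv (𝓡 m) (𝓡 (m + 1)) (ψ ∘ (ι ∘ φ.symm)) x =
      fderiv ℝ (patch g ι N φ ψ).f x := mfderiv_eq_fderiv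
  have hd : DifferentiableAt ℝ (patch g ι N φ ψ).f x := by
    have := (h3.comp x (h2.comp x h1)).differentiableAt
    exact this
  have e4 : (patch g ι N φ ψ).tangent i x c =
      (fderiv ℝ (patch g ι N φ ψ).f x (EuclideanSpace.single i 1)) c := by
    have hc := ((EuclideanSpace.proj (𝕜 := ℝ) c).hasFDerivAt.comp x hd.hasFDerivAt).fderiv
    have : (patch g ι N φ ψ).tangent i x c = fderiv ℝ
      ((EuclideanSpace.proj (𝕜 := ℝ) c) ∘ (patch g ι N φ ψ).f) x (EuclideanSpace.single i 1) := rfl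
    rw [this, hc]; rfl
  rw [e4, ← e3, e1, e2]; rfl

theorem contMDiffOn_tangent_chart (hψ : ψ ∈ IsManifold.maximalAtlas (𝓡 (m + 1)) ∞ M') :
    ContMDiffOn (𝓡 (m + 1)).tangent (𝓡 (m + 1)).tangent ∞
      (tangentMap (𝓡 (m + 1)) (𝓡 (m + 1)) ψ)
      (Bundle.TotalSpace.proj (F := EuclideanSpace ℝ (Fin (m + 1)))
        (E := TangentSpace (𝓡 (m + 1)) (M := M')) ⁻¹' ψ.source) := by
  have := (contMDiffOn_of_mem_maximalAtlas hψ).contMDiffOn_tangentMapWithin (m := ∞) (by simp)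
    ψ.open_source.uniqueMDiffOn
  refine this.congr fun p hp => ?_
  simp only [tangentMap, tangentMapWithin]
  rw [mfderivWithin_of_isOpen ψ.open_source hp]

theorem contMDiffOn_tangent_chart_symm (hψ : ψ ∈ IsManifold.maximalAtlas (𝓡 (m + 1)) ∞ M') :
    ContMDiffOn (𝓡 (m + 1)).tangent (𝓡 (m + 1)).tangent ∞
      (tangentMap (𝓡 (m + 1)) (𝓡 (m + 1)) ψ.symm)
      (Bundle.TotalSpace.proj (F := EuclideanSpace ℝ (Fin (m + 1)))
        (E := TangentSpace (𝓡 (m + 1)) (M := EuclideanSpace ℝ (Fin (m + 1)))) ⁻¹' ψ.target) := by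
  have := (contMDiffOn_symm_of_mem_maximalAtlas hψ).contMDiffOn_tangentMapWithin (m := ∞) (by simp)
    ψ.open_target.uniqueMDiffOn
  refine this.congr fun p hp => ?_
  simp only [tangentMap, tangentMapWithin]
  rw [mfderivWithin_of_isOpen ψ.open_target hp]

/-- The coordinate fields are images of constant fields under the tangent map of `ψ.symm`, hence
smooth sections along `ψ.symm`, to which the smooth metric is applied. -/
theorem patch_contDiffOn_G (hψ : ψ ∈ IsManifold.maximalAtlas (𝓡 (m + 1)) ∞ M')
    (a b : Fin (m + 1)) :
    ContDiffOn ℝ ∞ (fun y => (patch g ι N φ ψ).G y a b) ψ.target := by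
  rw [← contMDiffOn_iff_contDiffOn]
  have hs : ∀ c : Fin (m + 1), ContMDiffOn (𝓡 (m + 1)) (𝓡 (m + 1)).tangent ∞
      (fun y : EuclideanSpace ℝ (Fin (m + 1)) => (⟨ψ.symm y,
        mfderiv (𝓡 (m + 1)) (𝓡 (m + 1)) ψ.symm y (EuclideanSpace.single c (1 : ℝ))⟩ :
          TangentBundle (𝓡 (m + 1)) M')) ψ.target := by
    intro c
    have h1 : ContMDiff (𝓡 (m + 1)) (𝓡 (m + 1)).tangent ∞
        (fun y : EuclideanSpace ℝ (Fin (m + 1)) => (⟨y, EuclideanSpace.single c (1 : ℝ)⟩ :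
          TangentBundle (𝓡 (m + 1)) (EuclideanSpace ℝ (Fin (m + 1))))) := by
      intro y
      rw [← contMDiffWithinAt_univ]
      exact contMDiffWithinAt_vectorSpace_iff_contDiffWithinAt.2 contDiffWithinAt_const
    exact (contMDiffOn_tangent_chart_symm hψ).comp h1.contMDiffOn fun y hy => hy
  intro y hy
  have := ContMDiffWithinAt.clm_bundle_apply₂ (F₁ := EuclideanSpace ℝ (Fin (m + 1)))
    (F₂ := EuclideanSpace ℝ (Fin (m + 1))) (F₃ := ℝ) (E₃ := Bundle.Trivial M' ℝ)
    (ψ := fun y => g.inner (ψ.symm y))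
    (ContMDiffAt.comp_contMDiffWithinAt y g.contMDiff.contMDiffAt
      (contMDiffOn_symm_of_mem_maximalAtlas hψ y hy)) (hs a y hy) (hs b y hy)
  simp only [Bundle.contMDiffWithinAt_totalSpace] at this
  exact this.2

theorem patch_contDiffOn_N (hN : IsUnitNormal g ι U N)
    (hφ : φ ∈ IsManifold.maximalAtlas (𝓡 m) ∞ M)
    (hψ : ψ ∈ IsManifold.maximalAtlas (𝓡 (m + 1)) ∞ M') (c : Fin (m + 1)) :
    ContDiffOn ℝ ∞ (fun x => (patch g ι N φ ψ).N x c) (patchDomain ι U φ ψ) := by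
  have h1 : ContMDiffOn (𝓡 m) (𝓡 (m + 1)).tangent ∞
      (fun x => (⟨ι (φ.symm x), N (φ.symm x)⟩ : TangentBundle (𝓡 (m + 1)) M'))
      (patchDomain ι U φ ψ) :=
    hN.1.comp ((contMDiffOn_symm_of_mem_maximalAtlas hφ).mono fun x hx => hx.1)
      fun x hx => hx.2.1
  have h2 := (contMDiffOn_tangent_chart hψ).comp h1 fun x hx => hx.2.2
  have h3 := (contMDiff_snd_tangentBundle_modelSpace (𝕜 := ℝ) (EuclideanSpace ℝ (Fin (m + 1)))
    (𝓡 (m + 1)) (n := ∞)).comp_contMDiffOn h2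
  have h4 := contMDiffOn_iff_contDiffOn.1 h3
  exact (EuclideanSpace.proj (𝕜 := ℝ) c).contDiff.comp_contDiffOn h4

/-- The coordinate expression of a hypersurface in charts is regular on its domain. -/
theorem patch_isRegularOn (hι : IsHypersurface (m := m) ι) (hU : IsOpen U) (hN : IsUnitNormal g ι U N)
    (hφ : φ ∈ IsManifold.maximalAtlas (𝓡 m) ∞ M)
    (hψ : ψ ∈ IsManifold.maximalAtlas (𝓡 (m + 1)) ∞ M') :
    (patch g ι N φ ψ).IsRegularOn (patchDomain ι U φ ψ) ψ.target where
  isOpen_left := isOpen_patchDomain hι hU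
  isOpen_right := ψ.open_target
  mapsTo := fun x hx => ψ.map_source hx.2.2
  smooth_G := patch_contDiffOn_G g hψ
  smooth_f := patch_contDiffOn_f g hι hφ hψ
  smooth_N := patch_contDiffOn_N g hN hφ hψ
  symm := fun y a b => g.symm _ _ _
  pos := by
    intro y hy u hu
    have h := patch_sum_G (ι := ι) (N := N) (φ := φ) (ψ := ψ) g y (WithLp.toLp 2 u)
      (WithLp.toLp 2 u)
    -- The differential of `ψ.symm` has the differential of `ψ` as a left inverse, so it sends `u ≠
    -- 0` to a nonzero vector.
    refine lt_of_lt_of_eq (g.pos _ _ fun h0 => hu ?_) h.symm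
    have h1 := mfderiv_chart_mfderiv_chart_symm hψ hy (WithLp.toLp 2 u)
    rw [h0] at h1
    have h2 : (0 : EuclideanSpace ℝ (Fin (m + 1))) = WithLp.toLp 2 u := by
      rw [← h1]; exact (map_zero (mfderiv (𝓡 (m + 1)) (𝓡 (m + 1)) ψ (ψ.symm y))).symm
    ext c
    exact congrArg (fun z : EuclideanSpace ℝ (Fin (m + 1)) => z c) h2.symm
  unit := by
    intro x hx
    exact (patch_sum_G_mfderiv g hψ hx.2.2 _ _).trans (hN.2 _ hx.2.1).1
  orth := by
    intro x hx i
    simp only [patch_tangent g hι hφ hψ hx]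
    exact (patch_sum_G_mfderiv g hψ hx.2.2 _ _).trans ((hN.2 _ hx.2.1).2 _)
  indep := by
    intro x hx
    rw [Fintype.linearIndependent_iff]
    intro k hk
    set L : EuclideanSpace ℝ (Fin m) →L[ℝ] EuclideanSpace ℝ (Fin (m + 1)) :=
      (mfderiv (𝓡 (m + 1)) (𝓡 (m + 1)) ψ (ι (φ.symm x))).comp
        ((mfderiv (𝓡 m) (𝓡 (m + 1)) ι (φ.symm x)).comp (mfderiv (𝓡 m) (𝓡 m) φ.symm x)) with hL
    -- The differential of `ι` is injective by the immersion hypothesis; the two chart differentials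
    -- have left inverses.
    have hinj : Function.Injective L := by
      refine Function.Injective.comp (g := mfderiv (𝓡 (m + 1)) (𝓡 (m + 1)) ψ (ι (φ.symm x))) ?_
        (Function.Injective.comp (g := mfderiv (𝓡 m) (𝓡 (m + 1)) ι (φ.symm x)) (hι.2 _) ?_)
      · exact Function.LeftInverse.injective (mfderiv_chart_symm_mfderiv_chart hψ hx.2.2)
      · exact Function.LeftInverse.injective (mfderiv_chart_mfderiv_chart_symm hφ hx.1)
    have h0 : L (WithLp.toLp 2 k) = 0 := by
      rw [euclidean_eq_sum_single (WithLp.toLp 2 k), map_sum]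
      ext c
      have := congrFun hk c
      simp only [Finset.sum_apply, Pi.smul_apply, patch_tangent g hι hφ hψ hx, smul_eq_mul,
        Pi.zero_apply] at this
      simp only [map_smul, PiLp.zero_apply, WithLp.ofLp_sum, Finset.sum_apply, PiLp.smul_apply,
        smul_eq_mul]
      exact this
    have h1 : WithLp.toLp 2 k = (0 : EuclideanSpace ℝ (Fin m)) :=
      hinj (h0.trans (map_zero L).symm)
    intro i
    exact congrArg (fun z : EuclideanSpace ℝ (Fin m) => z i) h1

end Metric

/-! ### Calculus of differential forms by coefficients -/

section FormCalculus

variable {m : ℕ}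

/-- Smoothness of a differential form on a set, coefficient by coefficient. -/
def FormSmoothOn (η : Coord m → Forms m) (W : Set (Coord m)) : Prop :=
  ∀ s, ContDiffOn ℝ ∞ (fun y => formCoeff s (η y)) W

/-- Partial derivative of a differential form, coefficient by coefficient. -/
def formPd (i : Fin m) (η : Coord m → Forms m) (x : Coord m) : Forms m :=
  ∑ s : Finset (Fin m), (fderiv ℝ (fun y => formCoeff s (η y)) x (EuclideanSpace.single i 1)) •
    formBasis m s

theorem sum_formCoeff (a : Forms m) : ∑ s, formCoeff s a • formBasis m s = a :=
  (formBasis m).sum_repr a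

theorem formCoeff_formBasis (s t : Finset (Fin m)) :
    formCoeff s (formBasis m t) = if t = s then 1 else 0 := by
  simp [formCoeff, Finsupp.single_apply]

theorem formCoeff_sum_smul (c : Finset (Fin m) → ℂ) (s : Finset (Fin m)) :
    formCoeff s (∑ t, c t • formBasis m t) = c s := by
  simp [formCoeff_formBasis]

theorem ext_formCoeff {a b : Forms m} (h : ∀ s, formCoeff s a = formCoeff s b) : a = b := by
  rw [← sum_formCoeff a, ← sum_formCoeff b]
  simp [h]

/-- The wedge product has constant structure coefficients in the basis, so smoothness and
derivatives of products reduce to those of scalar functions. -/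
theorem formCoeff_mul (s : Finset (Fin m)) (a b : Forms m) :
    formCoeff s (a * b) = ∑ p, ∑ q, formCoeff p a * formCoeff q b *
      formCoeff s (formBasis m p * formBasis m q) := by
  conv_lhs => rw [← sum_formCoeff a, ← sum_formCoeff b]
  simp only [Finset.sum_mul, Finset.mul_sum, smul_mul_smul_comm, map_sum, map_smul, smul_eq_mul]
  exact Finset.sum_comm

theorem formCoeff_formPd (s : Finset (Fin m)) (i : Fin m) (η : Coord m → Forms m) (x : Coord m) :
    formCoeff s (formPd i η x) =
      fderiv ℝ (fun y => formCoeff s (η y)) x (EuclideanSpace.single i 1) :=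
  formCoeff_sum_smul _ s

/-- Separates analysis from signs: `formPd i` is an ungraded derivation, and the signs in the
Leibniz rules arise only from moving `dx i` past a factor. -/
theorem extD_eq_sum (η : Coord m → Forms m) (x : Coord m) :
    extD η x = ∑ i, dx i * formPd i η x := by
  simp only [extD, formPd, Finset.mul_sum, mul_smul_comm]
  exact Finset.sum_comm

variable {W : Set (Coord m)} {η θ : Coord m → Forms m} {x : Coord m}

theorem FormSmoothOn.congr (hη : FormSmoothOn η W) (h : ∀ y ∈ W, θ y = η y) :
    FormSmoothOn θ W :=
  fun s => (hη s).congr fun y hy => by rw [h y hy]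

theorem FormSmoothOn.const (a : Forms m) : FormSmoothOn (fun _ => a) W :=
  fun _ => contDiffOn_const

theorem FormSmoothOn.add (hη : FormSmoothOn η W) (hθ : FormSmoothOn θ W) :
    FormSmoothOn (fun y => η y + θ y) W :=
  fun s => ((hη s).add (hθ s)).congr fun _ _ => map_add _ _ _

theorem FormSmoothOn.sum {α : Type*} {A : Finset α} {η : α → Coord m → Forms m}
    (hη : ∀ a ∈ A, FormSmoothOn (η a) W) : FormSmoothOn (fun y => ∑ a ∈ A, η a y) W :=
  fun s => (ContDiffOn.sum fun a ha => hη a ha s).congr fun _ _ => map_sum _ _ _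

theorem FormSmoothOn.const_smul (c : ℂ) (hη : FormSmoothOn η W) :
    FormSmoothOn (fun y => c • η y) W :=
  fun s => ((hη s).const_smul c).congr fun _ _ => map_smul _ _ _

theorem FormSmoothOn.mul (hη : FormSmoothOn η W) (hθ : FormSmoothOn θ W) :
    FormSmoothOn (fun y => η y * θ y) W := fun s => by
  simp only [fun y => formCoeff_mul s (η y) (θ y)]
  exact ContDiffOn.sum fun p _ => ContDiffOn.sum fun q _ =>
    ((hη p).mul (hθ q)).mul contDiffOn_const

theorem FormSmoothOn.pow (hη : FormSmoothOn η W) (k : ℕ) :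
    FormSmoothOn (fun y => η y ^ k) W := by
  induction k with
  | zero => simpa using FormSmoothOn.const 1
  | succ k ih => simpa only [pow_succ] using ih.mul hη

theorem contDiffOn_complex_ofReal {u : Coord m → ℝ} (hu : ContDiffOn ℝ ∞ u W) :
    ContDiffOn ℝ ∞ (fun y => (u y : ℂ)) W :=
  Complex.ofRealCLM.contDiff.comp_contDiffOn hu

theorem FormSmoothOn.ofReal_smul {u : Coord m → ℝ} (hu : ContDiffOn ℝ ∞ u W)
    (hη : FormSmoothOn η W) : FormSmoothOn (fun y => (u y : ℂ) • η y) W :=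
  fun s => ((contDiffOn_complex_ofReal hu).mul (hη s)).congr fun y _ => by
    simp

theorem FormSmoothOn.differentiableAt (hη : FormSmoothOn η W) (hW : IsOpen W) (hx : x ∈ W)
    (s : Finset (Fin m)) : DifferentiableAt ℝ (fun y => formCoeff s (η y)) x :=
  ((hη s).contDiffAt (hW.mem_nhds hx)).differentiableAt (by simp)

theorem FormSmoothOn.formPd (hη : FormSmoothOn η W) (hW : IsOpen W) (i : Fin m) :
    FormSmoothOn (formPd i η) W := fun s => by
  simp only [formCoeff_formPd]
  exact ((hη s).fderiv_of_isOpen hW (by simp)).clm_apply contDiffOn_const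

theorem FormSmoothOn.extD (hη : FormSmoothOn η W) (hW : IsOpen W) :
    FormSmoothOn (extD η) W := by
  refine FormSmoothOn.congr (FormSmoothOn.sum fun i _ => ?_) fun y _ => extD_eq_sum η y
  exact (FormSmoothOn.const _).mul (hη.formPd hW i)

theorem formPd_congr (h : η =ᶠ[nhds x] θ) (i : Fin m) : formPd i η x = formPd i θ x := by
  refine ext_formCoeff fun s => ?_
  rw [formCoeff_formPd, formCoeff_formPd]
  have : (fun y => formCoeff s (η y)) =ᶠ[nhds x] fun y => formCoeff s (θ y) :=
    h.mono fun y hy => congrArg _ hy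
  rw [this.fderiv_eq]

theorem extD_congr (h : η =ᶠ[nhds x] θ) : extD η x = extD θ x := by
  simp only [extD_eq_sum, formPd_congr h]

theorem extD_congr_of_isOpen (hW : IsOpen W) (hx : x ∈ W) (h : ∀ y ∈ W, η y = θ y) :
    extD η x = extD θ x :=
  extD_congr (Filter.eventually_of_mem (hW.mem_nhds hx) h)

theorem formPd_add (hW : IsOpen W) (hx : x ∈ W) (hη : FormSmoothOn η W) (hθ : FormSmoothOn θ W)
    (i : Fin m) : formPd i (fun y => η y + θ y) x = formPd i η x + formPd i θ x := by
  refine ext_formCoeff fun s => ?_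
  simp only [formCoeff_formPd, map_add]
  rw [fderiv_fun_add (hη.differentiableAt hW hx s) (hθ.differentiableAt hW hx s)]
  rfl

theorem formPd_sum (hW : IsOpen W) (hx : x ∈ W) {α : Type*} {A : Finset α}
    {η : α → Coord m → Forms m} (hη : ∀ a ∈ A, FormSmoothOn (η a) W) (i : Fin m) :
    formPd i (fun y => ∑ a ∈ A, η a y) x = ∑ a ∈ A, formPd i (η a) x := by
  refine ext_formCoeff fun s => ?_
  simp only [formCoeff_formPd, map_sum]
  rw [fderiv_fun_sum fun a ha => (hη a ha).differentiableAt hW hx s]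
  simp

theorem formPd_mul (hW : IsOpen W) (hx : x ∈ W) (hη : FormSmoothOn η W) (hθ : FormSmoothOn θ W)
    (i : Fin m) :
    formPd i (fun y => η y * θ y) x = formPd i η x * θ x + η x * formPd i θ x := by
  refine ext_formCoeff fun s => ?_
  rw [map_add, formCoeff_mul, formCoeff_mul, formCoeff_formPd]
  simp only [fun y => formCoeff_mul s (η y) (θ y), formCoeff_formPd]
  have h : HasFDerivAt (fun y => ∑ p, ∑ q, formCoeff p (η y) * formCoeff q (θ y) *
      formCoeff s (formBasis m p * formBasis m q)) _ x :=
    HasFDerivAt.fun_sum fun p _ => HasFDerivAt.fun_sum fun q _ =>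
      (((hη.differentiableAt hW hx p).hasFDerivAt.mul
        (hθ.differentiableAt hW hx q).hasFDerivAt).mul_const _)
  rw [h.fderiv, ← Finset.sum_add_distrib]
  simp only [sum_apply, add_apply, smul_apply, ← Finset.sum_add_distrib, smul_eq_mul]
  refine Finset.sum_congr rfl fun p _ => Finset.sum_congr rfl fun q _ => ?_
  ring

theorem formPd_const (a : Forms m) (i : Fin m) : formPd i (fun _ => a) x = 0 := by
  refine ext_formCoeff fun s => ?_
  simp [formCoeff_formPd]

theorem formPd_const_smul (hW : IsOpen W) (hx : x ∈ W) (hη : FormSmoothOn η W) (c : ℂ)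
    (i : Fin m) : formPd i (fun y => c • η y) x = c • formPd i η x := by
  refine ext_formCoeff fun s => ?_
  simp only [formCoeff_formPd, map_smul]
  rw [fderiv_fun_const_smul (hη.differentiableAt hW hx s)]
  rfl

theorem formPd_ofReal_smul (hW : IsOpen W) (hx : x ∈ W) {u : Coord m → ℝ}
    (hu : ContDiffOn ℝ ∞ u W) (hη : FormSmoothOn η W) (i : Fin m) :
    formPd i (fun y => (u y : ℂ) • η y) x = (pd i u x : ℂ) • η x + (u x : ℂ) • formPd i η x := by
  refine ext_formCoeff fun s => ?_
  simp only [formCoeff_formPd, map_smul, map_add, smul_eq_mul]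
  have hu' : HasFDerivAt u (fderiv ℝ u x) x :=
    ((hu.contDiffAt (hW.mem_nhds hx)).differentiableAt (by simp)).hasFDerivAt
  have h1 := Complex.ofRealCLM.hasFDerivAt.comp x hu'
  have h2 := h1.mul (hη.differentiableAt hW hx s).hasFDerivAt
  have h3 : fderiv ℝ (fun y => (u y : ℂ) * formCoeff s (η y)) x = _ := h2.fderiv
  rw [h3]
  simp [pd]
  ring

theorem formPd_comm (hW : IsOpen W) (hx : x ∈ W) (hη : FormSmoothOn η W) (i j : Fin m) :
    formPd i (formPd j η) x = formPd j (formPd i η) x := by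
  refine ext_formCoeff fun s => ?_
  simp only [formCoeff_formPd]
  have h := (hη s).contDiffAt (hW.mem_nhds hx)
  have hs : IsSymmSndFDerivAt ℝ (fun y => formCoeff s (η y)) x :=
    h.isSymmSndFDerivAt (by simpa using ENat.LEInfty.out)
  have hd : DifferentiableAt ℝ (fderiv ℝ fun y => formCoeff s (η y)) x :=
    (h.fderiv_right (m := ∞) (by simp)).differentiableAt (by simp)
  have key : ∀ k l : Fin m, fderiv ℝ (fun y => fderiv ℝ (fun y => formCoeff s (η y)) y
      (EuclideanSpace.single k (1 : ℝ))) x (EuclideanSpace.single l 1) =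
      fderiv ℝ (fderiv ℝ fun y => formCoeff s (η y)) x (EuclideanSpace.single l 1)
        (EuclideanSpace.single k 1) := by
    intro k l
    rw [fderiv_clm_apply hd (differentiableAt_const _)]
    simp
  rw [key, key]
  exact hs _ _

/-! ### Degrees and signs -/

theorem dx_mem (i : Fin m) : dx i ∈ LinearMap.range (ExteriorAlgebra.ι ℂ (M := Fin m → ℂ)) :=
  ⟨_, rfl⟩

theorem mul_eq_neg_mul_of_mem_range {a b : Forms m}
    (ha : a ∈ LinearMap.range (ExteriorAlgebra.ι ℂ (M := Fin m → ℂ)))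
    (hb : b ∈ LinearMap.range (ExteriorAlgebra.ι ℂ (M := Fin m → ℂ))) : a * b = -(b * a) := by
  obtain ⟨u, rfl⟩ := ha
  obtain ⟨v, rfl⟩ := hb
  exact eq_neg_of_add_eq_zero_left (ExteriorAlgebra.ι_add_mul_swap u v)

theorem dx_mul_dx (i j : Fin m) : (dx i * dx j : Forms m) = -(dx j * dx i) :=
  mul_eq_neg_mul_of_mem_range (dx_mem i) (dx_mem j)

/-- Moving a generator past two one-forms changes the sign twice. Centrality serves below as the
working substitute for even degree. -/
theorem mem_center_of_mem_sq {a : Forms m} (ha : a ∈ ⋀[ℂ]^2 (Fin m → ℂ)) :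
    a ∈ Subalgebra.center ℂ (Forms m) := by
  rw [ExteriorAlgebra.exteriorPower, pow_two] at ha
  refine Submodule.mul_induction_on ha (fun u hu v hv => ?_) fun u v hu hv => add_mem hu hv
  rw [Subalgebra.mem_center_iff]
  intro b
  induction b using ExteriorAlgebra.induction with
  | algebraMap r => exact Algebra.commutes r _
  | ι c =>
    have h1 := mul_eq_neg_mul_of_mem_range ⟨c, rfl⟩ hu
    have h2 := mul_eq_neg_mul_of_mem_range ⟨c, rfl⟩ hv
    rw [← mul_assoc, h1, neg_mul, mul_assoc, h2, mul_neg, neg_neg, mul_assoc]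
  | mul a b ha hb => rw [mul_assoc, hb, ← mul_assoc, ha, mul_assoc]
  | add a b ha hb => rw [add_mul, mul_add, ha, hb]

/-- The exterior power has dimension `m.choose n = 0`. -/
theorem eq_zero_of_mem_exteriorPower {n : ℕ} (hn : m < n) {a : Forms m}
    (ha : a ∈ ⋀[ℂ]^n (Fin m → ℂ)) : a = 0 := by
  have h : Module.finrank ℂ (⋀[ℂ]^n (Fin m → ℂ)) = 0 := by
    rw [exteriorPower.finrank_eq]
    simpa using Nat.choose_eq_zero_of_lt hn
  have := Module.finrank_zero_iff.1 h
  exact congrArg Subtype.val (Subsingleton.elim (⟨a, ha⟩ : ⋀[ℂ]^n (Fin m → ℂ)) 0)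

theorem mul_mem_exteriorPower {p q : ℕ} {a b : Forms m} (ha : a ∈ ⋀[ℂ]^p (Fin m → ℂ))
    (hb : b ∈ ⋀[ℂ]^q (Fin m → ℂ)) : a * b ∈ ⋀[ℂ]^(p + q) (Fin m → ℂ) := by
  rw [ExteriorAlgebra.exteriorPower, pow_add]
  exact Submodule.mul_mem_mul ha hb

theorem pow_mem_exteriorPower {p : ℕ} {a : Forms m} (ha : a ∈ ⋀[ℂ]^p (Fin m → ℂ)) (k : ℕ) :
    a ^ k ∈ ⋀[ℂ]^(p * k) (Fin m → ℂ) := by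
  rw [ExteriorAlgebra.exteriorPower, pow_mul]
  exact Submodule.pow_mem_pow _ ha k

theorem mem_one_of_mem_range {a : Forms m}
    (ha : a ∈ LinearMap.range (ExteriorAlgebra.ι ℂ (M := Fin m → ℂ))) :
    a ∈ ⋀[ℂ]^1 (Fin m → ℂ) := by
  rwa [ExteriorAlgebra.exteriorPower, pow_one]

theorem mul_mem_sq {a b : Forms m}
    (ha : a ∈ LinearMap.range (ExteriorAlgebra.ι ℂ (M := Fin m → ℂ)))
    (hb : b ∈ LinearMap.range (ExteriorAlgebra.ι ℂ (M := Fin m → ℂ))) :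
    a * b ∈ ⋀[ℂ]^2 (Fin m → ℂ) :=
  mul_mem_exteriorPower (p := 1) (q := 1) (mem_one_of_mem_range ha) (mem_one_of_mem_range hb)

theorem sum_smul_dx_mem (c : Fin m → ℂ) :
    ∑ i, c i • dx i ∈ LinearMap.range (ExteriorAlgebra.ι ℂ (M := Fin m → ℂ)) :=
  Submodule.sum_mem _ fun i _ => Submodule.smul_mem _ _ (dx_mem i)

/-! ### The exterior derivative -/

theorem extD_add (hW : IsOpen W) (hx : x ∈ W) (hη : FormSmoothOn η W) (hθ : FormSmoothOn θ W) :
    extD (fun y => η y + θ y) x = extD η x + extD θ x := by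
  simp only [extD_eq_sum, formPd_add hW hx hη hθ, mul_add, Finset.sum_add_distrib]

theorem extD_sum (hW : IsOpen W) (hx : x ∈ W) {α : Type*} {A : Finset α}
    {η : α → Coord m → Forms m} (hη : ∀ a ∈ A, FormSmoothOn (η a) W) :
    extD (fun y => ∑ a ∈ A, η a y) x = ∑ a ∈ A, extD (η a) x := by
  simp only [extD_eq_sum, formPd_sum hW hx hη, Finset.mul_sum]
  exact Finset.sum_comm

theorem extD_const_smul (hW : IsOpen W) (hx : x ∈ W) (hη : FormSmoothOn η W) (c : ℂ) :
    extD (fun y => c • η y) x = c • extD η x := by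
  simp only [extD_eq_sum, formPd_const_smul hW hx hη, Finset.smul_sum, mul_smul_comm]

theorem extD_neg (hW : IsOpen W) (hx : x ∈ W) (hη : FormSmoothOn η W) :
    extD (fun y => -η y) x = -extD η x := by
  have := extD_const_smul hW hx hη (-1)
  simpa only [neg_one_smul] using this

theorem extD_zero : extD (fun _ => (0 : Forms m)) x = 0 := by
  simp [extD_eq_sum, formPd_const]

theorem extD_ofReal_smul (hW : IsOpen W) (hx : x ∈ W) {u : Coord m → ℝ}
    (hu : ContDiffOn ℝ ∞ u W) (hη : FormSmoothOn η W) :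
    extD (fun y => (u y : ℂ) • η y) x =
      (∑ i, (pd i u x : ℂ) • dx i) * η x + (u x : ℂ) • extD η x := by
  simp only [extD_eq_sum, formPd_ofReal_smul hW hx hu hη, mul_add, Finset.sum_add_distrib,
    Finset.sum_mul, mul_smul_comm, smul_mul_assoc, Finset.smul_sum]

/-- The Leibniz rule for a form of even degree. -/
theorem extD_mul_of_mem_center (hW : IsOpen W) (hx : x ∈ W) (hη : FormSmoothOn η W)
    (hθ : FormSmoothOn θ W) (hc : η x ∈ Subalgebra.center ℂ (Forms m)) :
    extD (fun y => η y * θ y) x = extD η x * θ x + η x * extD θ x := by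
  simp only [extD_eq_sum, formPd_mul hW hx hη hθ, mul_add, Finset.sum_add_distrib, Finset.sum_mul,
    Finset.mul_sum]
  congr 1 <;> refine Finset.sum_congr rfl fun i _ => ?_
  · rw [mul_assoc]
  · rw [← mul_assoc, ← mul_assoc, Subalgebra.mem_center_iff.1 hc]

/-- The Leibniz rule for a form of degree one. -/
theorem extD_mul_of_mem_range (hW : IsOpen W) (hx : x ∈ W) (hη : FormSmoothOn η W)
    (hθ : FormSmoothOn θ W)
    (hc : η x ∈ LinearMap.range (ExteriorAlgebra.ι ℂ (M := Fin m → ℂ))) :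
    extD (fun y => η y * θ y) x = extD η x * θ x - η x * extD θ x := by
  simp only [extD_eq_sum, formPd_mul hW hx hη hθ, mul_add, Finset.sum_add_distrib, Finset.sum_mul,
    Finset.mul_sum, sub_eq_add_neg, ← Finset.sum_neg_distrib]
  congr 1 <;> refine Finset.sum_congr rfl fun i _ => ?_
  · rw [mul_assoc]
  · rw [← mul_assoc, ← mul_assoc, mul_eq_neg_mul_of_mem_range (dx_mem i) hc, neg_mul]

theorem extD_extD (hW : IsOpen W) (hx : x ∈ W) (hη : FormSmoothOn η W) :
    extD (extD η) x = 0 := by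
  have h1 : extD (extD η) x = ∑ i, ∑ j, dx i * dx j * formPd i (formPd j η) x := by
    rw [extD_congr_of_isOpen hW hx fun y _ => extD_eq_sum η y, extD_eq_sum]
    refine Finset.sum_congr rfl fun i _ => ?_
    rw [formPd_sum hW hx fun j _ => (FormSmoothOn.const _).mul (hη.formPd hW j), Finset.mul_sum]
    refine Finset.sum_congr rfl fun j _ => ?_
    rw [formPd_mul hW hx (FormSmoothOn.const _) (hη.formPd hW j), formPd_const, zero_mul, zero_add,
      mul_assoc]
  -- Exchanging `i` and `j` flips the sign of `dx i * dx j` and preserves the second partial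
  -- derivatives.
  have h2 : extD (extD η) x = -extD (extD η) x := by
    conv_lhs => rw [h1, Finset.sum_comm]
    rw [h1, ← Finset.sum_neg_distrib]
    refine Finset.sum_congr rfl fun i _ => ?_
    rw [← Finset.sum_neg_distrib]
    refine Finset.sum_congr rfl fun j _ => ?_
    rw [dx_mul_dx j i, formPd_comm hW hx hη j i, neg_mul]
  have h3 : (2 : ℂ) • extD (extD η) x = 0 := by
    rw [two_smul]; exact add_eq_zero_iff_eq_neg.2 h2
  simpa using h3

variable {u : Fin m → Coord m → ℝ}

theorem FormSmoothOn.oneForm (hu : ∀ i, ContDiffOn ℝ ∞ (u i) W) :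
    FormSmoothOn (fun y => ∑ i, (u i y : ℂ) • dx i) W :=
  FormSmoothOn.sum fun i _ => FormSmoothOn.ofReal_smul (hu i) (FormSmoothOn.const _)

theorem extD_oneForm_mem_sq (hW : IsOpen W) (hx : x ∈ W) (hu : ∀ i, ContDiffOn ℝ ∞ (u i) W) :
    extD (fun y => ∑ i, (u i y : ℂ) • dx i) x ∈ ⋀[ℂ]^2 (Fin m → ℂ) := by
  rw [extD_sum hW hx fun i _ => FormSmoothOn.ofReal_smul (hu i) (FormSmoothOn.const _)]
  refine Submodule.sum_mem _ fun i _ => ?_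
  rw [extD_ofReal_smul hW hx (hu i) (FormSmoothOn.const _)]
  have : extD (fun _ => (dx i : Forms m)) x = 0 := by simp [extD_eq_sum, formPd_const]
  rw [this, smul_zero, add_zero]
  exact mul_mem_sq (sum_smul_dx_mem _) (dx_mem i)

end FormCalculus

theorem sum_sum_sum_reverse {ι R : Type*} [Fintype ι] [AddCommMonoid R] (F : ι → ι → ι → R) :
    ∑ a, ∑ b, ∑ c, F a b c = ∑ a, ∑ b, ∑ c, F c b a := by
  rw [Finset.sum_comm, Finset.sum_congr rfl fun b _ => Finset.sum_comm, Finset.sum_comm]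

/-! ### Christoffel symbols and the compatibility of the Levi-Civita connection with the metric -/

section Christoffel

variable {n : ℕ} {V : Set (Coord n)} {y : Coord n}

theorem contDiffOn_pd (hV : IsOpen V) {u : Coord n → ℝ} (hu : ContDiffOn ℝ ∞ u V) (i : Fin n) :
    ContDiffOn ℝ ∞ (pd i u) V :=
  (hu.fderiv_of_isOpen hV (by simp)).clm_apply contDiffOn_const

theorem pd_congr_of_isOpen (hV : IsOpen V) (hy : y ∈ V) {u w : Coord n → ℝ}
    (h : ∀ z ∈ V, u z = w z) (i : Fin n) : pd i u y = pd i w y := by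
  have : u =ᶠ[nhds y] w := Filter.eventually_of_mem (hV.mem_nhds hy) h
  rw [pd, pd, this.fderiv_eq]

theorem pd_comm (hV : IsOpen V) (hy : y ∈ V) {u : Coord n → ℝ} (hu : ContDiffOn ℝ ∞ u V)
    (i j : Fin n) : pd i (pd j u) y = pd j (pd i u) y := by
  have h := hu.contDiffAt (hV.mem_nhds hy)
  have hs : IsSymmSndFDerivAt ℝ u y := h.isSymmSndFDerivAt (by simpa using ENat.LEInfty.out)
  have hd : DifferentiableAt ℝ (fderiv ℝ u) y :=
    (h.fderiv_right (m := ∞) (by simp)).differentiableAt (by simp)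
  have key : ∀ k l : Fin n, pd l (pd k u) y =
      fderiv ℝ (fderiv ℝ u) y (EuclideanSpace.single l 1) (EuclideanSpace.single k 1) := by
    intro k l
    have : pd l (pd k u) y = fderiv ℝ (fun z => fderiv ℝ u z (EuclideanSpace.single k (1 : ℝ))) y
      (EuclideanSpace.single l 1) := rfl
    rw [this, fderiv_clm_apply hd (differentiableAt_const _)]
    simp
  rw [key, key]
  exact hs _ _

theorem contDiffOn_det {ι : Type*} [Fintype ι] [DecidableEq ι] {A : Coord n → Matrix ι ι ℝ}
    (hA : ∀ a b, ContDiffOn ℝ ∞ (fun y => A y a b) V) :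
    ContDiffOn ℝ ∞ (fun y => (A y).det) V := by
  simp only [Matrix.det_apply]
  exact ContDiffOn.sum fun σ _ => (contDiffOn_prod fun i _ => hA _ _).const_smul _

/-- By Cramer's rule the entries of the inverse are determinants divided by the nonvanishing
determinant; determinants are polynomial in the entries. -/
theorem contDiffOn_inv {ι : Type*} [Fintype ι] [DecidableEq ι] {A : Coord n → Matrix ι ι ℝ}
    (hA : ∀ a b, ContDiffOn ℝ ∞ (fun y => A y a b) V) (h0 : ∀ y ∈ V, (A y).det ≠ 0) (a b : ι) :
    ContDiffOn ℝ ∞ (fun y => (A y)⁻¹ a b) V := by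
  simp only [Matrix.inv_def, Matrix.smul_apply, Matrix.adjugate_apply, smul_eq_mul,
    Ring.inverse_eq_inv']
  refine ((contDiffOn_det hA).inv h0).mul (contDiffOn_det fun c d => ?_)
  rcases eq_or_ne c b with rfl | h
  · simpa using contDiffOn_const
  · simpa [Matrix.updateRow_ne h] using hA c d

theorem contDiffOn_christoffel (hV : IsOpen V) {G : Coord n → Matrix (Fin n) (Fin n) ℝ}
    (hG : ∀ a b, ContDiffOn ℝ ∞ (fun y => G y a b) V) (h0 : ∀ y ∈ V, (G y).det ≠ 0)
    (c a b : Fin n) : ContDiffOn ℝ ∞ (fun y => christoffel G y c a b) V := by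
  refine contDiffOn_const.mul (ContDiffOn.sum fun d _ => (contDiffOn_inv hG h0 c d).mul ?_)
  exact ((contDiffOn_pd hV (hG _ _) _).add (contDiffOn_pd hV (hG _ _) _)).sub
    (contDiffOn_pd hV (hG _ _) _)

variable {G : Coord n → Matrix (Fin n) (Fin n) ℝ}

theorem christoffel_comm (hG : ∀ y a b, G y a b = G y b a) (c a b : Fin n) :
    christoffel G y c a b = christoffel G y c b a := by
  unfold christoffel
  congr 1
  refine Finset.sum_congr rfl fun d _ => ?_
  rw [show (fun z => G z a b) = fun z => G z b a from funext fun z => hG z a b]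
  ring

/-- Lowering the index cancels `G⁻¹` and leaves the Christoffel symbols of the first kind. -/
theorem sum_mul_christoffel (h0 : (G y).det ≠ 0) (e a b : Fin n) :
    ∑ c, G y e c * christoffel G y c a b =
      1 / 2 * (pd a (fun z => G z b e) y + pd b (fun z => G z a e) y -
        pd e (fun z => G z a b) y) := by
  set K : Fin n → ℝ := fun d => pd a (fun z => G z b d) y + pd b (fun z => G z a d) y -
    pd d (fun z => G z a b) y with hK
  have h1 : ∀ c, christoffel G y c a b = 1 / 2 * ((G y)⁻¹.mulVec K) c := fun c => rfl
  have h2 : ((G y).mulVec ((G y)⁻¹.mulVec K)) e = K e := by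
    rw [Matrix.mulVec_mulVec, Matrix.mul_nonsing_inv _ (Ne.isUnit h0), Matrix.one_mulVec]
  calc ∑ c, G y e c * christoffel G y c a b = 1 / 2 * ((G y).mulVec ((G y)⁻¹.mulVec K)) e := by
        simp only [h1]
        rw [Matrix.mulVec, dotProduct, Finset.mul_sum]
        exact Finset.sum_congr rfl fun c _ => by ring
    _ = _ := by rw [h2]

/-- The Levi-Civita connection is metric. -/
theorem pd_metric_eq_sum_christoffel (hG : ∀ y a b, G y a b = G y b a) (h0 : (G y).det ≠ 0)
    (e a b : Fin n) :
    pd e (fun z => G z a b) y =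
      ∑ c, G y b c * christoffel G y c e a + ∑ c, G y a c * christoffel G y c e b := by
  rw [sum_mul_christoffel h0, sum_mul_christoffel h0,
    show (fun z => G z b a) = fun z => G z a b from funext fun z => hG z b a]
  ring

end Christoffel

/-! ### Submanifold geometry: metric connection along `f`, Gauss and Weingarten formulas -/

namespace Patch

variable {m : ℕ} {P : Patch m}

variable (P) in
/-- The inner product of the outer manifold at the point `f x`. -/
def ip (x : Coord m) : LinearMap.BilinForm ℝ (Fin (m + 1) → ℝ) := Matrix.toBilin' (P.G (P.f x))

theorem ip_apply (x : Coord m) (u w : Fin (m + 1) → ℝ) :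
    P.ip x u w = ∑ a, ∑ b, P.G (P.f x) a b * u a * w b := by
  rw [ip, Matrix.toBilin'_apply]
  exact Finset.sum_congr rfl fun a _ => Finset.sum_congr rfl fun b _ => by ring

theorem metric_eq_ip (x : Coord m) (i j : Fin m) :
    P.metric x i j = P.ip x (P.tangent i x) (P.tangent j x) :=
  (ip_apply x _ _).symm

theorem secondFF_eq_ip (x : Coord m) (i j : Fin m) :
    P.secondFF x i j = P.ip x (P.covOut i (P.tangent j) x) (P.N x) :=
  (ip_apply x _ _).symm

namespace IsRegularOn

variable {W : Set (Coord m)} {V : Set (Coord (m + 1))} {x : Coord m}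

theorem ip_comm (h : P.IsRegularOn W V) (u w : Fin (m + 1) → ℝ) : P.ip x u w = P.ip x w u := by
  rw [ip_apply, ip_apply, Finset.sum_comm]
  refine Finset.sum_congr rfl fun a _ => Finset.sum_congr rfl fun b _ => ?_
  rw [h.symm]; ring

theorem ip_self_pos (h : P.IsRegularOn W V) (hx : x ∈ W) {u : Fin (m + 1) → ℝ} (hu : u ≠ 0) :
    0 < P.ip x u u := by
  rw [ip_apply]; exact h.pos _ (h.mapsTo x hx) u hu

theorem ip_N_N (h : P.IsRegularOn W V) (hx : x ∈ W) : P.ip x (P.N x) (P.N x) = 1 := by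
  rw [ip_apply]; exact h.unit x hx

theorem ip_tangent_N (h : P.IsRegularOn W V) (hx : x ∈ W) (i : Fin m) :
    P.ip x (P.tangent i x) (P.N x) = 0 := by
  rw [ip_apply]; exact h.orth x hx i

theorem det_G_ne_zero (h : P.IsRegularOn W V) {y : Coord (m + 1)} (hy : y ∈ V) :
    (P.G y).det ≠ 0 := by
  intro h0
  obtain ⟨v, hv, hv0⟩ := Matrix.exists_mulVec_eq_zero_iff.2 h0
  refine (h.pos y hy v hv).ne' ?_
  refine Finset.sum_eq_zero fun a _ => ?_
  have := congrFun hv0 a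
  rw [Matrix.mulVec, dotProduct, Pi.zero_apply] at this
  calc ∑ b, P.G y a b * v a * v b = v a * ∑ b, P.G y a b * v b := by
        rw [Finset.mul_sum]; exact Finset.sum_congr rfl fun b _ => by ring
    _ = 0 := by rw [this, mul_zero]

theorem metric_comm (h : P.IsRegularOn W V) (x : Coord m) (i j : Fin m) :
    P.metric x i j = P.metric x j i := by
  rw [metric_eq_ip, metric_eq_ip, h.ip_comm]

/-- A kernel vector `v` would give the tangent vector `∑ vᵢ ∂ᵢ f`, nonzero by independence, of
squared length zero. -/
theorem det_metric_ne_zero (h : P.IsRegularOn W V) (hx : x ∈ W) : (P.metric x).det ≠ 0 := by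
  intro h0
  obtain ⟨v, hv, hv0⟩ := Matrix.exists_mulVec_eq_zero_iff.2 h0
  have h1 : ∑ i, v i • P.tangent i x ≠ 0 := fun h2 =>
    hv (funext (Fintype.linearIndependent_iff.1 (h.indep x hx) v h2))
  refine (h.ip_self_pos hx h1).ne' ?_
  simp only [map_sum, map_smul, LinearMap.sum_apply, LinearMap.smul_apply, smul_eq_mul]
  refine Finset.sum_eq_zero fun i _ => ?_
  have := congrFun hv0 i
  rw [Matrix.mulVec, dotProduct, Pi.zero_apply] at this
  simp only [← metric_eq_ip]
  calc _ = v i * ∑ j, P.metric x i j * v j := by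
        congr 1; exact Finset.sum_congr rfl fun j _ => by rw [h.metric_comm]; ring
    _ = 0 := by rw [this, mul_zero]

/-! ### Smoothness of the geometric quantities -/

theorem contDiffOn_f_apply (h : P.IsRegularOn W V) (c : Fin (m + 1)) :
    ContDiffOn ℝ ∞ (fun x => P.f x c) W :=
  (EuclideanSpace.proj (𝕜 := ℝ) c).contDiff.comp_contDiffOn h.smooth_f

theorem contDiffOn_tangent (h : P.IsRegularOn W V) (i : Fin m) (c : Fin (m + 1)) :
    ContDiffOn ℝ ∞ (fun x => P.tangent i x c) W :=
  contDiffOn_pd h.isOpen_left (h.contDiffOn_f_apply c) i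

theorem contDiffOn_G_f (h : P.IsRegularOn W V) (a b : Fin (m + 1)) :
    ContDiffOn ℝ ∞ (fun x => P.G (P.f x) a b) W :=
  (h.smooth_G a b).comp h.smooth_f h.mapsTo

theorem contDiffOn_christoffel_f (h : P.IsRegularOn W V) (c a b : Fin (m + 1)) :
    ContDiffOn ℝ ∞ (fun x => christoffel P.G (P.f x) c a b) W :=
  (contDiffOn_christoffel h.isOpen_right h.smooth_G (fun _ hy => h.det_G_ne_zero hy) c a b).comp
    h.smooth_f h.mapsTo

theorem contDiffOn_ip (h : P.IsRegularOn W V) {s t : Coord m → Fin (m + 1) → ℝ}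
    (hs : ∀ c, ContDiffOn ℝ ∞ (fun x => s x c) W) (ht : ∀ c, ContDiffOn ℝ ∞ (fun x => t x c) W) :
    ContDiffOn ℝ ∞ (fun x => P.ip x (s x) (t x)) W := by
  simp only [ip_apply]
  exact ContDiffOn.sum fun a _ => ContDiffOn.sum fun b _ =>
    ((h.contDiffOn_G_f a b).mul (hs a)).mul (ht b)

theorem contDiffOn_metric (h : P.IsRegularOn W V) (i j : Fin m) :
    ContDiffOn ℝ ∞ (fun x => P.metric x i j) W := by
  simp only [metric_eq_ip]
  exact h.contDiffOn_ip (h.contDiffOn_tangent i) (h.contDiffOn_tangent j)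

theorem contDiffOn_christoffel_metric (h : P.IsRegularOn W V) (k i j : Fin m) :
    ContDiffOn ℝ ∞ (fun x => christoffel P.metric x k i j) W :=
  contDiffOn_christoffel h.isOpen_left h.contDiffOn_metric (fun _ hx => h.det_metric_ne_zero hx) k i j

theorem contDiffOn_covOut (h : P.IsRegularOn W V) {s : Coord m → Fin (m + 1) → ℝ}
    (hs : ∀ c, ContDiffOn ℝ ∞ (fun x => s x c) W) (i : Fin m) (c : Fin (m + 1)) :
    ContDiffOn ℝ ∞ (fun x => P.covOut i s x c) W :=
  (contDiffOn_pd h.isOpen_left (hs c) i).add <| ContDiffOn.sum fun a _ => ContDiffOn.sum fun b _ =>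
    ((h.contDiffOn_christoffel_f c a b).mul (h.contDiffOn_tangent i a)).mul (hs b)

theorem contDiffOn_secondFF (h : P.IsRegularOn W V) (i j : Fin m) :
    ContDiffOn ℝ ∞ (fun x => P.secondFF x i j) W := by
  simp only [secondFF_eq_ip]
  exact h.contDiffOn_ip (h.contDiffOn_covOut (h.contDiffOn_tangent j) i) h.smooth_N

theorem contDiffOn_weingarten (h : P.IsRegularOn W V) (k i : Fin m) :
    ContDiffOn ℝ ∞ (fun x => P.weingarten x k i) W :=
  ContDiffOn.sum fun j _ => (contDiffOn_inv h.contDiffOn_metric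
    (fun _ hx => h.det_metric_ne_zero hx) k j).mul (h.contDiffOn_secondFF i j)

/-! ### Gauss and Weingarten formulas -/

theorem pd_comp_f (h : P.IsRegularOn W V) (hx : x ∈ W) {u : Coord (m + 1) → ℝ}
    (hu : ContDiffOn ℝ ∞ u V) (i : Fin m) :
    pd i (fun z => u (P.f z)) x = ∑ e, pd e u (P.f x) * P.tangent i x e := by
  have hu' := ((hu.contDiffAt (h.isOpen_right.mem_nhds (h.mapsTo x hx))).differentiableAt
    (by simp)).hasFDerivAt
  have hf := ((h.smooth_f.contDiffAt (h.isOpen_left.mem_nhds hx)).differentiableAt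
    (by simp)).hasFDerivAt
  have ht : ∀ c, P.tangent i x c = (fderiv ℝ P.f x (EuclideanSpace.single i 1)) c := by
    intro c
    have hc := ((EuclideanSpace.proj (𝕜 := ℝ) c).hasFDerivAt.comp x hf).fderiv
    have : P.tangent i x c = fderiv ℝ ((EuclideanSpace.proj (𝕜 := ℝ) c) ∘ P.f) x
      (EuclideanSpace.single i 1) := rfl
    rw [this, hc]; rfl
  have h1 : pd i (fun z => u (P.f z)) x =
      fderiv ℝ u (P.f x) (fderiv ℝ P.f x (EuclideanSpace.single i 1)) := by
    have := (hu'.comp x hf).fderiv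
    rw [pd, show (fun z => u (P.f z)) = u ∘ P.f from rfl, this]; rfl
  rw [h1, euclidean_eq_sum_single (fderiv ℝ P.f x (EuclideanSpace.single i 1)), map_sum]
  refine Finset.sum_congr rfl fun e _ => ?_
  rw [map_smul, ht, smul_eq_mul, pd, mul_comm]

/-- The pulled back outer connection is metric: differentiate `G ∘ f` by the chain rule and use that
the Levi-Civita connection of `G` is metric. -/
theorem pd_ip (h : P.IsRegularOn W V) (hx : x ∈ W) {s t : Coord m → Fin (m + 1) → ℝ}
    (hs : ∀ c, ContDiffOn ℝ ∞ (fun x => s x c) W) (ht : ∀ c, ContDiffOn ℝ ∞ (fun x => t x c) W)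
    (i : Fin m) :
    pd i (fun z => P.ip z (s z) (t z)) x =
      P.ip x (P.covOut i s x) (t x) + P.ip x (s x) (P.covOut i t x) := by
  have hdiff : ∀ {u : Coord m → ℝ}, ContDiffOn ℝ ∞ u W → HasFDerivAt u (fderiv ℝ u x) x :=
    fun hu => ((hu.contDiffAt (h.isOpen_left.mem_nhds hx)).differentiableAt (by simp)).hasFDerivAt
  have h1 : pd i (fun z => P.ip z (s z) (t z)) x = ∑ a, ∑ b,
      (pd i (fun z => P.G (P.f z) a b) x * s x a * t x b +
        P.G (P.f x) a b * pd i (fun z => s z a) x * t x b +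
        P.G (P.f x) a b * s x a * pd i (fun z => t z b) x) := by
    simp only [ip_apply]
    have hd : HasFDerivAt (fun z => ∑ a, ∑ b, P.G (P.f z) a b * s z a * t z b) _ x :=
      HasFDerivAt.fun_sum fun a _ => HasFDerivAt.fun_sum fun b _ =>
        ((hdiff (h.contDiffOn_G_f a b)).mul (hdiff (hs a))).mul (hdiff (ht b))
    rw [pd, hd.fderiv]
    simp only [sum_apply, add_apply, smul_apply, smul_eq_mul, Pi.mul_apply]
    refine Finset.sum_congr rfl fun a _ => Finset.sum_congr rfl fun b _ => ?_
    simp only [pd]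
    ring
  have hG : ∀ a b, pd i (fun z => P.G (P.f z) a b) x =
      ∑ c, P.G (P.f x) b c * (∑ e, christoffel P.G (P.f x) c e a * P.tangent i x e) +
      ∑ c, P.G (P.f x) a c * (∑ e, christoffel P.G (P.f x) c e b * P.tangent i x e) := by
    intro a b
    rw [h.pd_comp_f hx (h.smooth_G a b)]
    simp only [pd_metric_eq_sum_christoffel h.symm (h.det_G_ne_zero (h.mapsTo x hx)), add_mul,
      Finset.sum_add_distrib, Finset.sum_mul, Finset.mul_sum]
    congr 1 <;> rw [Finset.sum_comm] <;>
      exact Finset.sum_congr rfl fun c _ => Finset.sum_congr rfl fun e _ => by ring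
  -- `Θ` is the matrix of the restricted connection in direction `i`; keeping it opaque reduces the
  -- rest to relabelling triple sums.
  obtain ⟨Θ, hΘ⟩ : ∃ Θ : Fin (m + 1) → Fin (m + 1) → ℝ,
      ∀ c a, ∑ e, christoffel P.G (P.f x) c e a * P.tangent i x e = Θ c a := ⟨_, fun _ _ => rfl⟩
  have hcov : ∀ (r : Coord m → Fin (m + 1) → ℝ) c,
      P.covOut i r x c = pd i (fun z => r z c) x + ∑ b, Θ c b * r x b := by
    intro r c
    rw [covOut, Finset.sum_comm]
    simp only [← hΘ, Finset.sum_mul]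
  simp only [hΘ] at hG
  rw [h1, ip_apply, ip_apply]
  simp only [hG, hcov, mul_add, add_mul, Finset.sum_add_distrib, Finset.sum_mul, Finset.mul_sum]
  have e1 : ∑ a, ∑ b, ∑ c, P.G (P.f x) b c * Θ c a * s x a * t x b =
      ∑ a, ∑ b, ∑ c, P.G (P.f x) a b * (Θ a c * s x c) * t x b := by
    rw [sum_sum_sum_reverse]
    refine Finset.sum_congr rfl fun a _ => Finset.sum_congr rfl fun b _ =>
      Finset.sum_congr rfl fun c _ => ?_
    rw [h.symm _ b a]; ring
  have e2 : ∑ a, ∑ b, ∑ c, P.G (P.f x) a c * Θ c b * s x a * t x b =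
      ∑ a, ∑ b, ∑ c, P.G (P.f x) a b * s x a * (Θ b c * t x c) := by
    refine Finset.sum_congr rfl fun a _ => ?_
    rw [Finset.sum_comm]
    exact Finset.sum_congr rfl fun b _ => Finset.sum_congr rfl fun c _ => by ring
  rw [e1, e2]
  ring

/-- Torsion freeness: second partial derivatives of `f` and the lower indices of the Christoffel
symbols are symmetric. -/
theorem covOut_tangent_comm (h : P.IsRegularOn W V) (hx : x ∈ W) (i j : Fin m) :
    P.covOut i (P.tangent j) x = P.covOut j (P.tangent i) x := by
  ext c
  simp only [covOut]
  congr 1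
  · exact pd_comm h.isOpen_left hx (h.contDiffOn_f_apply c) i j
  · rw [Finset.sum_comm]
    refine Finset.sum_congr rfl fun a _ => Finset.sum_congr rfl fun b _ => ?_
    rw [christoffel_comm h.symm]; ring

theorem pd_metric (h : P.IsRegularOn W V) (hx : x ∈ W) (i j k : Fin m) :
    pd i (fun z => P.metric z j k) x = P.ip x (P.covOut i (P.tangent j) x) (P.tangent k x) +
      P.ip x (P.covOut i (P.tangent k) x) (P.tangent j x) := by
  simp only [metric_eq_ip]
  rw [h.pd_ip hx (h.contDiffOn_tangent j) (h.contDiffOn_tangent k), h.ip_comm (P.tangent j x)]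

/-- Koszul argument: expanding the three derivatives of the induced metric gives six inner products,
four of which cancel by torsion freeness. The tangential part of the outer connection is thus the
Levi-Civita connection of the induced metric. -/
theorem sum_metric_mul_christoffel (h : P.IsRegularOn W V) (hx : x ∈ W) (i j l : Fin m) :
    ∑ k, P.metric x l k * christoffel P.metric x k i j =
      P.ip x (P.covOut i (P.tangent j) x) (P.tangent l x) := by
  rw [sum_mul_christoffel (h.det_metric_ne_zero hx), h.pd_metric hx, h.pd_metric hx,
    h.pd_metric hx, h.covOut_tangent_comm hx j i, h.covOut_tangent_comm hx l i,
    h.covOut_tangent_comm hx l j]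
  ring

theorem sum_metric_mul_weingarten (h : P.IsRegularOn W V) (hx : x ∈ W) (i l : Fin m) :
    ∑ k, P.metric x l k * P.weingarten x k i = P.secondFF x i l := by
  have h1 : ∀ k, P.weingarten x k i = ((P.metric x)⁻¹.mulVec (P.secondFF x i)) k := fun k => rfl
  have h2 : ((P.metric x).mulVec ((P.metric x)⁻¹.mulVec (P.secondFF x i))) l = P.secondFF x i l := by
    rw [Matrix.mulVec_mulVec, Matrix.mul_nonsing_inv _ (Ne.isUnit (h.det_metric_ne_zero hx)),
      Matrix.one_mulVec]
  simp only [h1]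
  exact h2

/-- A vector orthogonal to the frame `∂₁ f, …, ∂ₘ f, N` vanishes. -/
theorem eq_zero_of_ip_eq_zero (h : P.IsRegularOn W V) (hx : x ∈ W) {u : Fin (m + 1) → ℝ}
    (ht : ∀ l, P.ip x u (P.tangent l x) = 0) (hn : P.ip x u (P.N x) = 0) : u = 0 := by
  set e : Fin m ⊕ Unit → Fin (m + 1) → ℝ :=
    Sum.elim (fun i => P.tangent i x) (fun _ => P.N x) with he
  have hli : LinearIndependent ℝ e := by
    rw [Fintype.linearIndependent_iff]
    intro c hc
    rw [Fintype.sum_sum_type] at hc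
    simp only [he, Sum.elim_inl, Sum.elim_inr, Finset.univ_unique, Finset.sum_singleton] at hc
    have hN : c (Sum.inr default) = 0 := by
      have := congrArg (fun v => P.ip x v (P.N x)) hc
      simpa [h.ip_tangent_N hx, h.ip_N_N hx] using this
    rw [hN, zero_smul, add_zero] at hc
    have hT := Fintype.linearIndependent_iff.1 (h.indep x hx) _ hc
    rintro (i | _)
    · exact hT i
    · exact hN
  -- The frame consists of `m + 1` independent vectors in dimension `m + 1`. So `u` lies in their
  -- span and is orthogonal to itself.
  have hspan := hli.span_eq_top_of_card_eq_finrank' (by simp)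
  by_contra hu
  refine (h.ip_self_pos hx hu).ne' ?_
  have hmem : u ∈ Submodule.span ℝ (Set.range e) := hspan ▸ Submodule.mem_top
  have hle : Submodule.span ℝ (Set.range e) ≤ LinearMap.ker (P.ip x u) := by
    rw [Submodule.span_le]
    rintro _ ⟨i | _, rfl⟩
    · exact ht i
    · exact hn
  exact hle hmem

/-- The Gauss formula. -/
theorem covOut_tangent (h : P.IsRegularOn W V) (hx : x ∈ W) (i j : Fin m) :
    P.covOut i (P.tangent j) x =
      ∑ k, christoffel P.metric x k i j • P.tangent k x + P.secondFF x i j • P.N x := by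
  rw [← sub_eq_zero]
  refine h.eq_zero_of_ip_eq_zero hx (fun l => ?_) ?_
  · simp only [map_sub, map_add, map_sum, map_smul, LinearMap.sub_apply, LinearMap.add_apply,
      LinearMap.sum_apply, LinearMap.smul_apply, smul_eq_mul, h.ip_comm (P.N x),
      h.ip_tangent_N hx, ← h.sum_metric_mul_christoffel hx, ← metric_eq_ip, h.metric_comm x _ l]
    simp [mul_comm]
  · simp only [map_sub, map_add, map_sum, map_smul, LinearMap.sub_apply, LinearMap.add_apply,
      LinearMap.sum_apply, LinearMap.smul_apply, smul_eq_mul, h.ip_N_N hx,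
      h.ip_tangent_N hx, ← secondFF_eq_ip]
    simp

/-- The Weingarten formula. -/
theorem covOut_N (h : P.IsRegularOn W V) (hx : x ∈ W) (i : Fin m) :
    P.covOut i P.N x = -∑ k, P.weingarten x k i • P.tangent k x := by
  rw [← sub_eq_zero, sub_neg_eq_add]
  -- To be applied to the constant functions `g(∂ₗ f, N) = 0` and `g(N, N) = 1`, whose derivatives
  -- determine the components of `∇^out N`.
  have hconst : ∀ (u : Coord m → ℝ) (c : ℝ), (∀ z ∈ W, u z = c) → pd i u x = 0 := by
    intro u c hu
    rw [pd_congr_of_isOpen h.isOpen_left hx (w := fun _ => c) hu]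
    simp [pd]
  refine h.eq_zero_of_ip_eq_zero hx (fun l => ?_) ?_
  · have h1 := h.pd_ip hx (h.contDiffOn_tangent l) h.smooth_N i
    rw [hconst _ 0 fun z hz => h.ip_tangent_N hz l, ← secondFF_eq_ip, h.ip_comm (P.tangent l x)]
      at h1
    simp only [map_add, map_sum, map_smul, LinearMap.add_apply,
      LinearMap.sum_apply, LinearMap.smul_apply, smul_eq_mul, ← metric_eq_ip]
    rw [h1, ← h.sum_metric_mul_weingarten hx, add_comm]
    congr 1
    exact Finset.sum_congr rfl fun k _ => by rw [h.metric_comm x k l, mul_comm]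
  · have h1 := h.pd_ip hx h.smooth_N h.smooth_N i
    rw [hconst _ 1 fun z hz => h.ip_N_N hz, h.ip_comm (P.N x)] at h1
    simp only [map_add, map_sum, map_smul, LinearMap.add_apply,
      LinearMap.sum_apply, LinearMap.smul_apply, smul_eq_mul, h.ip_tangent_N hx]
    simp
    linarith

theorem isOuterConnectionMatrix (h : P.IsRegularOn W V) (hx : x ∈ W) :
    P.IsOuterConnectionMatrix (P.nablaT 1 x) x := by
  rintro (j | _) c
  · rw [Fintype.sum_sum_type]
    simp only [frame, nablaT, nabla, wedgeN, h.covOut_tangent hx, leviCivita, covecII]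
    simp [-Complex.coe_smul, Finset.smul_sum, add_smul, Finset.sum_add_distrib, Finset.sum_smul, smul_smul]
    rw [Finset.sum_comm]
    simp only [mul_comm]
  · rw [Fintype.sum_sum_type]
    simp only [frame, nablaT, nabla, wedgeN, h.covOut_N hx, vecII]
    simp [-Complex.coe_smul, Finset.smul_sum, Finset.sum_smul, smul_smul]
    rw [Finset.sum_comm]
    simp only [mul_comm]

end IsRegularOn
end Patch

/-! ### Algebra of the powers of the curvature block matrix -/

section BlockPowers

variable {κ A : Type*} [Fintype κ] [DecidableEq κ] [Ring A] [Algebra ℂ A]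

/-- Matrices act from the left, so scalars on the right pass through without any commutativity of
`A`. -/
theorem mulVec_mul_const {ι : Type*} [Fintype ι] (M : Matrix ι ι A) (u : ι → A) (c : A) :
    M.mulVec (fun j => u j * c) = fun i => M.mulVec u i * c := by
  ext i
  simp only [Matrix.mulVec, dotProduct, Finset.sum_mul, mul_assoc]

theorem pow_apply_mem_center {ι : Type*} [Fintype ι] [DecidableEq ι] {M : Matrix ι ι A}
    (hM : ∀ i j, M i j ∈ Subalgebra.center ℂ A) (n : ℕ) (i j : ι) :
    (M ^ n) i j ∈ Subalgebra.center ℂ A := by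
  induction n generalizing i j with
  | zero =>
    rw [pow_zero, Matrix.one_apply]
    split_ifs
    · exact one_mem _
    · exact zero_mem _
  | succ n ih =>
    rw [pow_succ, Matrix.mul_apply]
    exact sum_mem fun l _ => mul_mem (ih i l) (hM l j)

/-- The block matrix of the curvature of the interpolated connection. -/
def curvBlock (R : Matrix κ κ A) (v b w c : κ → A) (t : ℂ) : Matrix (κ ⊕ Unit) (κ ⊕ Unit) A :=
  Matrix.fromBlocks (Matrix.of fun i j => R i j - t ^ 2 • (v i * b j))
    (Matrix.of fun i _ => -(t • w i)) (Matrix.of fun _ j => t • c j) 0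

/-- The block matrix of the variation of the interpolated connection. -/
def velBlock (v b : κ → A) : Matrix (κ ⊕ Unit) (κ ⊕ Unit) A :=
  Matrix.fromBlocks 0 (Matrix.of fun i _ => -v i) (Matrix.of fun _ j => b j) 0

variable {R : Matrix κ κ A} {v b w c : κ → A} {t : ℂ} {ξ σ : A}

theorem curvBlock_mulVec (u : κ → A) (z : A) :
    (curvBlock R v b w c t).mulVec (Sum.elim u fun _ => z) =
      Sum.elim (fun i => ∑ j, R i j * u j - t ^ 2 • (v i * ∑ j, b j * u j) - t • (w i * z))
        fun _ => t • ∑ j, c j * u j := by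
  ext i
  rcases i with i | i
  · simp [curvBlock, Matrix.mulVec, dotProduct, sub_mul, Finset.mul_sum, Finset.smul_sum,
      mul_assoc, Finset.sum_sub_distrib, ← sub_eq_add_neg]
  · simp [curvBlock, Matrix.mulVec, dotProduct, Finset.smul_sum]

/-- The orbit of the normal column `(0, 1)`. An even power leaves a multiple of `v ξ` in the
tangential part, but `R v = 0`, `b v = 0` and `c v ξ = ξ² = 0` annihilate it at the next step, so
odd powers remain multiples of `w`. -/
theorem curvBlock_pow_odd_mulVec (hRv : ∀ i, ∑ j, R i j * v j = 0)
    (hRw : ∀ i, ∑ j, R i j * w j = 0) (hbv : ∑ j, b j * v j = 0) (hbw : ∑ j, b j * w j = ξ)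
    (hcv : ∑ j, c j * v j = ξ) (hcw : ∑ j, c j * w j = σ) (hξ : ξ * ξ = 0) (k : ℕ) :
    (curvBlock R v b w c t ^ (2 * k + 1)).mulVec (Sum.elim (fun _ => 0) fun _ => 1) =
      Sum.elim (fun i => -(t • (w i * (-t ^ 2 • σ) ^ k))) (fun _ => 0) ∧
    (curvBlock R v b w c t ^ (2 * k + 2)).mulVec (Sum.elim (fun _ => 0) fun _ => 1) =
      Sum.elim (fun i => t ^ 3 • (v i * (ξ * (-t ^ 2 • σ) ^ k)))
        (fun _ => (-t ^ 2 • σ) ^ (k + 1)) := by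
  -- The passage from an odd to an even power: `R w = 0`, `b w = ξ` yields `t³ v ξ s`, and `c w = σ`
  -- yields `-t² σ s`.
  have step : ∀ (s : A) , (curvBlock R v b w c t).mulVec
      (Sum.elim (fun i => -(t • (w i * s))) (fun _ => 0)) =
      Sum.elim (fun i => t ^ 3 • (v i * (ξ * s))) (fun _ => (-t ^ 2 • σ) * s) := by
    intro s
    rw [curvBlock_mulVec]
    simp only [mul_neg, mul_smul_comm, Finset.sum_neg_distrib, ← Finset.smul_sum, ← mul_assoc,
      ← Finset.sum_mul, hRw, hbw, hcw]
    congr 1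
    · ext i
      simp [smul_smul, mul_assoc]; ring_nf
    · ext i
      simp [smul_smul, pow_two]
  induction k with
  | zero =>
    have h1 : (curvBlock R v b w c t).mulVec (Sum.elim (fun _ => 0) fun _ => 1) =
        Sum.elim (fun i => -(t • (w i * 1))) (fun _ => 0) := by
      rw [curvBlock_mulVec]; simp
    refine ⟨by simpa using h1, ?_⟩
    rw [mul_zero, zero_add, pow_two, ← Matrix.mulVec_mulVec, h1, step]
    simp
  | succ k ih =>
    have h1 : (curvBlock R v b w c t ^ (2 * (k + 1) + 1)).mulVec
        (Sum.elim (fun _ => 0) fun _ => 1) =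
        Sum.elim (fun i => -(t • (w i * (-t ^ 2 • σ) ^ (k + 1)))) (fun _ => 0) := by
      rw [show 2 * (k + 1) + 1 = (2 * k + 2) + 1 by ring, pow_succ', ← Matrix.mulVec_mulVec, ih.2,
        curvBlock_mulVec]
      simp only [mul_smul_comm, ← Finset.smul_sum, ← mul_assoc, ← Finset.sum_mul, hRv, hbv, hcv, hξ]
      simp
    refine ⟨h1, ?_⟩
    rw [show 2 * (k + 1) + 2 = (2 * (k + 1) + 1) + 1 by ring, pow_succ', ← Matrix.mulVec_mulVec, h1,
      step, pow_succ' _ (k + 1)]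

/-- Only the normal column and the normal row of the power enter the trace, paired with `b` and `v`
respectively. Each pairing contributes `-t ξ (-t² σ)^k`. -/
theorem trace_velBlock_mul_curvBlock_pow (hR : ∀ i j, R i j ∈ Subalgebra.center ℂ A)
    (hw : ∀ i, w i ∈ Subalgebra.center ℂ A) (hc : ∀ i, c i ∈ Subalgebra.center ℂ A)
    (hvb : ∀ i j, v i * b j ∈ Subalgebra.center ℂ A) (hRv : ∀ i, ∑ j, R i j * v j = 0)
    (hRw : ∀ i, ∑ j, R i j * w j = 0) (hbv : ∑ j, b j * v j = 0) (hbw : ∑ j, b j * w j = ξ)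
    (hcv : ∑ j, c j * v j = ξ) (hcw : ∑ j, c j * w j = σ) (hξ : ξ * ξ = 0) (k : ℕ) :
    (velBlock v b * curvBlock R v b w c t ^ (2 * k + 1)).trace =
      -(2 * t) • (ξ * (-t ^ 2 • σ) ^ k) := by
  have hσ : σ ∈ Subalgebra.center ℂ A := hcw ▸ sum_mem fun j _ => mul_mem (hc j) (hw j)
  have hs : (-t ^ 2 • σ) ^ k ∈ Subalgebra.center ℂ A := pow_mem (Subalgebra.smul_mem _ hσ _) k
  have hM : ∀ i j, curvBlock R v b w c t i j ∈ Subalgebra.center ℂ A := by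
    rintro (i | i) (j | j)
    · exact sub_mem (hR i j) (Subalgebra.smul_mem _ (hvb i j) _)
    · exact neg_mem (Subalgebra.smul_mem _ (hw i) _)
    · exact Subalgebra.smul_mem _ (hc j) _
    · exact zero_mem _
  set M := curvBlock R v b w c t with hMdef
  have hodd := (curvBlock_pow_odd_mulVec (t := t) hRv hRw hbv hbw hcv hcw hξ k).1
  -- The power zero is separate, since the orbit lemma only covers positive even powers.
  have heven : (M ^ (2 * k)).mulVec (Sum.elim (fun _ => 0) fun _ => 1) (Sum.inr ()) =
      (-t ^ 2 • σ) ^ k := by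
    cases k with
    | zero => simp
    | succ k => rw [show 2 * (k + 1) = 2 * k + 2 by ring,
        (curvBlock_pow_odd_mulVec (t := t) hRv hRw hbv hbw hcv hcw hξ k).2]; rfl
  have hcol : ∀ j, (M ^ (2 * k + 1)) (Sum.inl j) (Sum.inr ()) =
      -(t • (w j * (-t ^ 2 • σ) ^ k)) := by
    intro j
    have := congrFun hodd (Sum.inl j)
    simpa [Matrix.mulVec, dotProduct] using this
  have hrow : ∑ i, (M ^ (2 * k + 1)) (Sum.inr ()) (Sum.inl i) * v i =
      t • ((-t ^ 2 • σ) ^ k * ξ) := by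
    -- `M` sends `(v, 0)` to `(0, t ξ)`, so the row entry of `M ^ (2k+1)` against `v` is read off
    -- from `M ^ (2k)` on the normal column.
    have h1 : M.mulVec (Sum.elim v fun _ => 0) =
        fun i => (Sum.elim (fun _ => 0) fun _ => 1 : κ ⊕ Unit → A) i * (t • ξ) := by
      rw [hMdef, curvBlock_mulVec, hbv, hcv]
      ext (i | i) <;> simp [hRv]
    have h2 : (M ^ (2 * k + 1)).mulVec (Sum.elim v fun _ => 0) (Sum.inr ()) =
        (-t ^ 2 • σ) ^ k * (t • ξ) := by
      rw [pow_succ, ← Matrix.mulVec_mulVec, h1, mulVec_mul_const]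
      exact congrArg (· * (t • ξ)) heven
    rw [mul_smul_comm] at h2
    rw [← h2]
    simp [Matrix.mulVec, dotProduct]
  have htr : (velBlock v b * M ^ (2 * k + 1)).trace =
      -(∑ i, v i * (M ^ (2 * k + 1)) (Sum.inr ()) (Sum.inl i)) +
        ∑ j, b j * (M ^ (2 * k + 1)) (Sum.inl j) (Sum.inr ()) := by
    simp [Matrix.trace, Matrix.mul_apply, velBlock]
  rw [htr]
  -- Here the entries of the power must be central: the trace has `vᵢ` on the left of them, whereas
  -- `hrow` has it on the right.
  simp only [fun i => Subalgebra.mem_center_iff.1 (pow_apply_mem_center hM (2 * k + 1) (Sum.inr ())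
    (Sum.inl i)) (v i), hrow, hcol, mul_neg, mul_smul_comm, ← mul_assoc, Finset.sum_neg_distrib,
    ← Finset.smul_sum, ← Finset.sum_mul, hbw]
  rw [← Subalgebra.mem_center_iff.1 hs ξ]
  module

end BlockPowers

/-! ### Exterior derivative of matrices of forms -/

section ExtDMat

variable {m : ℕ} {W : Set (Coord m)} {x : Coord m}
  {κ κ' κ'' : Type*} [Fintype κ']

/-- The exterior derivative of a matrix of forms. -/
def extDMat (A : Coord m → Matrix κ κ' (Forms m)) (x : Coord m) : Matrix κ κ' (Forms m) :=
  Matrix.of fun a b => extD (fun y => A y a b) x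

/-- Smoothness of a matrix of forms. -/
def MatSmoothOn (A : Coord m → Matrix κ κ' (Forms m)) (W : Set (Coord m)) : Prop :=
  ∀ a b, FormSmoothOn (fun y => A y a b) W

theorem MatSmoothOn.add {A B : Coord m → Matrix κ κ' (Forms m)} (hA : MatSmoothOn A W)
    (hB : MatSmoothOn B W) : MatSmoothOn (fun y => A y + B y) W :=
  fun a b => (hA a b).add (hB a b)

theorem MatSmoothOn.mul {A : Coord m → Matrix κ κ' (Forms m)}
    {B : Coord m → Matrix κ' κ'' (Forms m)} (hA : MatSmoothOn A W)
    (hB : MatSmoothOn B W) : MatSmoothOn (fun y => A y * B y) W :=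
  fun a b => FormSmoothOn.sum fun j _ => (hA a j).mul (hB j b)

theorem MatSmoothOn.extDMat {A : Coord m → Matrix κ κ' (Forms m)} (hA : MatSmoothOn A W)
    (hW : IsOpen W) : MatSmoothOn (extDMat A) W :=
  fun a b => (hA a b).extD hW

theorem extDMat_add {A B : Coord m → Matrix κ κ' (Forms m)} (hW : IsOpen W) (hx : x ∈ W)
    (hA : MatSmoothOn A W) (hB : MatSmoothOn B W) :
    extDMat (fun y => A y + B y) x = extDMat A x + extDMat B x := by
  ext a b
  exact extD_add hW hx (hA a b) (hB a b)

theorem extDMat_extDMat {A : Coord m → Matrix κ κ' (Forms m)} (hW : IsOpen W) (hx : x ∈ W)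
    (hA : MatSmoothOn A W) : extDMat (extDMat A) x = 0 := by
  ext a b
  exact extD_extD hW hx (hA a b)

theorem extDMat_congr {A B : Coord m → Matrix κ κ' (Forms m)} (hW : IsOpen W) (hx : x ∈ W)
    (h : ∀ y ∈ W, A y = B y) : extDMat A x = extDMat B x := by
  ext a b
  exact extD_congr_of_isOpen hW hx fun y hy => by rw [h y hy]

theorem extDMat_mul_of_mem_range {A : Coord m → Matrix κ κ' (Forms m)}
    {B : Coord m → Matrix κ' κ'' (Forms m)} (hW : IsOpen W) (hx : x ∈ W) (hA : MatSmoothOn A W)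
    (hB : MatSmoothOn B W)
    (h : ∀ a b, A x a b ∈ LinearMap.range (ExteriorAlgebra.ι ℂ (M := Fin m → ℂ))) :
    extDMat (fun y => A y * B y) x = extDMat A x * B x - A x * extDMat B x := by
  ext a b
  simp only [extDMat, Matrix.of_apply, Matrix.sub_apply, Matrix.mul_apply]
  rw [extD_sum hW hx fun j _ => (hA a j).mul (hB j b), ← Finset.sum_sub_distrib]
  exact Finset.sum_congr rfl fun j _ => extD_mul_of_mem_range hW hx (hA a j) (hB j b) (h a j)

theorem extDMat_mul_of_mem_center {A : Coord m → Matrix κ κ' (Forms m)}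
    {B : Coord m → Matrix κ' κ'' (Forms m)} (hW : IsOpen W) (hx : x ∈ W) (hA : MatSmoothOn A W)
    (hB : MatSmoothOn B W) (h : ∀ a b, A x a b ∈ Subalgebra.center ℂ (Forms m)) :
    extDMat (fun y => A y * B y) x = extDMat A x * B x + A x * extDMat B x := by
  ext a b
  simp only [extDMat, Matrix.of_apply, Matrix.add_apply, Matrix.mul_apply]
  rw [extD_sum hW hx fun j _ => (hA a j).mul (hB j b), ← Finset.sum_add_distrib]
  exact Finset.sum_congr rfl fun j _ => extD_mul_of_mem_center hW hx (hA a j) (hB j b) (h a j)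

end ExtDMat

/-! ### Consequences of permeability for `II`, `ξ` and the curvature of `∇ᵗ` -/

namespace Patch

variable {m : ℕ} (P : Patch m)

/-- The vector valued form `II` as a column. -/
def colII (x : Coord m) : Matrix (Fin m) Unit (Forms m) := Matrix.of fun k _ => P.vecII x k

/-- The covector valued form `g(II, ·)` as a row. -/
def rowII (x : Coord m) : Matrix Unit (Fin m) (Forms m) := Matrix.of fun _ j => P.covecII x j

/-- The covariant exterior derivative `d^∇ II` as a column. -/
def colDII (x : Coord m) : Matrix (Fin m) Unit (Forms m) := Matrix.of fun k _ => P.dII x k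

/-- The covariant exterior derivative of `g(II, ·)` as a row. -/
def rowDII (x : Coord m) : Matrix Unit (Fin m) (Forms m) :=
  extDMat P.rowII x + P.rowII x * P.leviCivita x

theorem colDII_eq (x : Coord m) : P.colDII x = extDMat P.colII x + P.leviCivita x * P.colII x := rfl

theorem curvature_leviCivita_eq (x : Coord m) :
    curvature P.leviCivita x = extDMat P.leviCivita x + P.leviCivita x * P.leviCivita x := rfl

theorem vecII_mem (x : Coord m) (k : Fin m) :
    P.vecII x k ∈ LinearMap.range (ExteriorAlgebra.ι ℂ (M := Fin m → ℂ)) := sum_smul_dx_mem _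

theorem covecII_mem (x : Coord m) (k : Fin m) :
    P.covecII x k ∈ LinearMap.range (ExteriorAlgebra.ι ℂ (M := Fin m → ℂ)) := sum_smul_dx_mem _

theorem leviCivita_mem (x : Coord m) (i j : Fin m) :
    P.leviCivita x i j ∈ LinearMap.range (ExteriorAlgebra.ι ℂ (M := Fin m → ℂ)) :=
  sum_smul_dx_mem _

namespace IsRegularOn

variable {P} {W : Set (Coord m)} {V : Set (Coord (m + 1))} {x : Coord m}

theorem matSmoothOn_colII (h : P.IsRegularOn W V) : MatSmoothOn P.colII W :=
  fun k _ => FormSmoothOn.oneForm fun i => h.contDiffOn_weingarten k i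

theorem matSmoothOn_rowII (h : P.IsRegularOn W V) : MatSmoothOn P.rowII W :=
  fun _ j => FormSmoothOn.oneForm fun i => h.contDiffOn_secondFF i j

theorem matSmoothOn_leviCivita (h : P.IsRegularOn W V) : MatSmoothOn P.leviCivita W :=
  fun k j => FormSmoothOn.oneForm fun i => h.contDiffOn_christoffel_metric k i j

theorem matSmoothOn_rowDII (h : P.IsRegularOn W V) : MatSmoothOn P.rowDII W :=
  (h.matSmoothOn_rowII.extDMat h.isOpen_left).add (h.matSmoothOn_rowII.mul h.matSmoothOn_leviCivita)

theorem matSmoothOn_curvature (h : P.IsRegularOn W V) : MatSmoothOn (curvature P.leviCivita) W :=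
  (h.matSmoothOn_leviCivita.extDMat h.isOpen_left).add
    (h.matSmoothOn_leviCivita.mul h.matSmoothOn_leviCivita)

theorem dII_mem_sq (h : P.IsRegularOn W V) (hx : x ∈ W) (k : Fin m) :
    P.dII x k ∈ ⋀[ℂ]^2 (Fin m → ℂ) :=
  add_mem (extD_oneForm_mem_sq h.isOpen_left hx fun i => h.contDiffOn_weingarten k i)
    (sum_mem fun _ _ => mul_mem_sq (P.leviCivita_mem x _ _) (P.vecII_mem x _))

theorem rowDII_mem_sq (h : P.IsRegularOn W V) (hx : x ∈ W) (a : Unit) (j : Fin m) :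
    P.rowDII x a j ∈ ⋀[ℂ]^2 (Fin m → ℂ) :=
  add_mem (extD_oneForm_mem_sq h.isOpen_left hx fun i => h.contDiffOn_secondFF i j)
    (by rw [Matrix.mul_apply]
        exact sum_mem fun _ _ => mul_mem_sq (P.covecII_mem x _) (P.leviCivita_mem x _ _))

theorem curvature_mem_sq (h : P.IsRegularOn W V) (hx : x ∈ W) (i j : Fin m) :
    curvature P.leviCivita x i j ∈ ⋀[ℂ]^2 (Fin m → ℂ) :=
  add_mem (extD_oneForm_mem_sq h.isOpen_left hx fun l => h.contDiffOn_christoffel_metric i l j)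
    (by rw [Matrix.mul_apply]
        exact sum_mem fun _ _ => mul_mem_sq (P.leviCivita_mem x _ _) (P.leviCivita_mem x _ _))

/-! ### Structure equations -/

theorem extDMat_colII (x : Coord m) :
    extDMat P.colII x = P.colDII x - P.leviCivita x * P.colII x :=
  eq_sub_of_add_eq (P.colDII_eq x).symm

theorem extDMat_rowII (x : Coord m) :
    extDMat P.rowII x = P.rowDII x - P.rowII x * P.leviCivita x :=
  (add_sub_cancel_right _ _).symm

theorem extDMat_leviCivita (x : Coord m) :
    extDMat P.leviCivita x = curvature P.leviCivita x - P.leviCivita x * P.leviCivita x :=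
  eq_sub_of_add_eq (P.curvature_leviCivita_eq x).symm

/-- The covariant identity `d^∇ d^∇ b = -b R` for the row `b = g(II, ·)`, from `d² = 0`. -/
theorem extDMat_rowDII (h : P.IsRegularOn W V) (hx : x ∈ W) :
    extDMat P.rowDII x =
      P.rowDII x * P.leviCivita x - P.rowII x * curvature P.leviCivita x := by
  have h1 := extDMat_add h.isOpen_left hx (h.matSmoothOn_rowII.extDMat h.isOpen_left)
    (h.matSmoothOn_rowII.mul h.matSmoothOn_leviCivita)
  rw [extDMat_extDMat h.isOpen_left hx h.matSmoothOn_rowII, zero_add,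
    extDMat_mul_of_mem_range h.isOpen_left hx h.matSmoothOn_rowII h.matSmoothOn_leviCivita
      (fun _ => P.covecII_mem x), extDMat_leviCivita, extDMat_rowII, Matrix.sub_mul, Matrix.mul_sub,
    Matrix.mul_assoc] at h1
  refine Eq.trans h1 ?_
  abel

/-- The second Bianchi identity. -/
theorem extDMat_curvature (h : P.IsRegularOn W V) (hx : x ∈ W) :
    extDMat (curvature P.leviCivita) x =
      curvature P.leviCivita x * P.leviCivita x - P.leviCivita x * curvature P.leviCivita x := by
  have h1 := extDMat_add h.isOpen_left hx (h.matSmoothOn_leviCivita.extDMat h.isOpen_left)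
    (h.matSmoothOn_leviCivita.mul h.matSmoothOn_leviCivita)
  rw [extDMat_extDMat h.isOpen_left hx h.matSmoothOn_leviCivita, zero_add,
    extDMat_mul_of_mem_range h.isOpen_left hx h.matSmoothOn_leviCivita h.matSmoothOn_leviCivita
      (P.leviCivita_mem x), extDMat_leviCivita, Matrix.sub_mul, Matrix.mul_sub,
    Matrix.mul_assoc] at h1
  refine Eq.trans h1 ?_
  abel

theorem covecII_eq_sum (h : P.IsRegularOn W V) (hx : x ∈ W) (j : Fin m) :
    P.covecII x j = ∑ k, (P.metric x j k : ℂ) • P.vecII x k := by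
  simp only [covecII, vecII, Finset.smul_sum, smul_smul]
  rw [Finset.sum_comm]
  refine Finset.sum_congr rfl fun i _ => ?_
  rw [← Finset.sum_smul, ← h.sum_metric_mul_weingarten hx]
  push_cast
  rfl

theorem sum_pd_metric_smul_dx (h : P.IsRegularOn W V) (hx : x ∈ W) (j k : Fin m) :
    ∑ i, (pd i (fun y => P.metric y j k) x : ℂ) • (dx i : Forms m) =
      ∑ l, (P.metric x j l : ℂ) • P.leviCivita x l k +
        ∑ l, (P.metric x k l : ℂ) • P.leviCivita x l j := by
  simp only [pd_metric_eq_sum_christoffel (G := P.metric) h.metric_comm (h.det_metric_ne_zero hx),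
    leviCivita, Matrix.of_apply, Finset.smul_sum, smul_smul]
  rw [Finset.sum_comm, Finset.sum_comm (f := fun l i => _ • dx i), ← Finset.sum_add_distrib]
  refine Finset.sum_congr rfl fun i _ => ?_
  rw [← Finset.sum_smul, ← Finset.sum_smul, ← add_smul, add_comm]
  push_cast
  rfl

/-- Lowering an index commutes with `d^∇` because `g` is parallel. This identifies the two covariant
derivatives `c` and `w`, whence `c v = b w = ξ`. -/
theorem rowDII_eq_sum (h : P.IsRegularOn W V) (hx : x ∈ W) (a : Unit) (j : Fin m) :
    P.rowDII x a j = ∑ k, (P.metric x j k : ℂ) • P.dII x k := by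
  have h1 : extD (fun y => P.covecII y j) x = ∑ k,
      ((∑ i, (pd i (fun y => P.metric y j k) x : ℂ) • dx i) * P.vecII x k +
        (P.metric x j k : ℂ) • extD (fun y => P.vecII y k) x) := by
    rw [extD_congr_of_isOpen h.isOpen_left hx fun y hy => h.covecII_eq_sum hy j]
    refine (extD_sum (η := fun k y => (P.metric y j k : ℂ) • P.vecII y k) h.isOpen_left hx
      fun k _ => FormSmoothOn.ofReal_smul (h.contDiffOn_metric j k)
        (h.matSmoothOn_colII k ())).trans ?_
    exact Finset.sum_congr rfl fun k _ =>
      extD_ofReal_smul h.isOpen_left hx (h.contDiffOn_metric j k) (h.matSmoothOn_colII k ())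
  -- One of the two terms of `dg`: the sign from swapping two one-forms makes it cancel the
  -- connection term of the row.
  have h2 : ∑ k, (∑ l, (P.metric x k l : ℂ) • P.leviCivita x l j) * P.vecII x k =
      -∑ l, P.covecII x l * P.leviCivita x l j := by
    simp only [h.covecII_eq_sum hx, Finset.sum_mul, ← Finset.sum_neg_distrib, smul_mul_assoc]
    rw [Finset.sum_comm]
    refine Finset.sum_congr rfl fun l _ => Finset.sum_congr rfl fun k _ => ?_
    rw [mul_eq_neg_mul_of_mem_range (P.leviCivita_mem x l j) (P.vecII_mem x k), h.metric_comm x k l,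
      smul_neg]
  have h3 : P.rowDII x a j =
      extD (fun y => P.covecII y j) x + ∑ l, P.covecII x l * P.leviCivita x l j := rfl
  rw [h3, h1, Finset.sum_add_distrib]
  simp only [h.sum_pd_metric_smul_dx hx, add_mul, Finset.sum_add_distrib]
  rw [h2]
  simp only [dII, smul_add, Finset.sum_add_distrib, Finset.smul_sum, Finset.sum_mul,
    smul_mul_assoc]
  rw [Finset.sum_comm]
  abel

/-! ### The forms `ξ` and `dξ` -/

theorem sum_rowDII_mul_vecII (h : P.IsRegularOn W V) (hx : x ∈ W) :
    ∑ l, P.rowDII x () l * P.vecII x l = P.xi x := by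
  simp only [h.rowDII_eq_sum hx, Finset.sum_mul, smul_mul_assoc, xi]
  rw [Finset.sum_comm]
  simp only [h.metric_comm x]

theorem dII_mem_center (h : P.IsRegularOn W V) (hx : x ∈ W) (k : Fin m) :
    P.dII x k ∈ Subalgebra.center ℂ (Forms m) := mem_center_of_mem_sq (h.dII_mem_sq hx k)

theorem rowDII_mem_center (h : P.IsRegularOn W V) (hx : x ∈ W) (a : Unit) (j : Fin m) :
    P.rowDII x a j ∈ Subalgebra.center ℂ (Forms m) := mem_center_of_mem_sq (h.rowDII_mem_sq hx a j)

theorem sum_covecII_mul_dII (h : P.IsRegularOn W V) (hx : x ∈ W) :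
    ∑ l, P.covecII x l * P.dII x l = P.xi x := by
  simp only [h.covecII_eq_sum hx, Finset.sum_mul, smul_mul_assoc, xi]
  refine Finset.sum_congr rfl fun k _ => Finset.sum_congr rfl fun l _ => ?_
  rw [Subalgebra.mem_center_iff.1 (h.dII_mem_center hx k)]

/-- The symmetric metric is contracted with an anticommuting product, so the sum equals its own
negative. -/
theorem sum_covecII_mul_vecII (h : P.IsRegularOn W V) (hx : x ∈ W) :
    ∑ l, P.covecII x l * P.vecII x l = 0 := by
  have h1 : ∑ l, P.covecII x l * P.vecII x l = -∑ l, P.covecII x l * P.vecII x l := by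
    simp only [h.covecII_eq_sum hx, Finset.sum_mul, smul_mul_assoc, ← Finset.sum_neg_distrib]
    conv_lhs => rw [Finset.sum_comm]
    refine Finset.sum_congr rfl fun k _ => Finset.sum_congr rfl fun l _ => ?_
    rw [h.metric_comm x, mul_eq_neg_mul_of_mem_range (P.vecII_mem x k) (P.vecII_mem x l), smul_neg]
  have h2 : (2 : ℂ) • ∑ l, P.covecII x l * P.vecII x l = 0 := by
    rw [two_smul]; exact add_eq_zero_iff_eq_neg.2 h1
  simpa using h2

theorem xi_eq_mul (h : P.IsRegularOn W V) (hx : x ∈ W) :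
    P.xi x = (P.rowDII x * P.colII x) () () :=
  (h.sum_rowDII_mul_vecII hx).symm

theorem formSmoothOn_xi (h : P.IsRegularOn W V) : FormSmoothOn P.xi W :=
  FormSmoothOn.congr ((h.matSmoothOn_rowDII.mul h.matSmoothOn_colII) () ()) fun _ hy => h.xi_eq_mul hy

/-- In the double sum over products of a central two-form and a one-form, exchanging the indices
flips the sign. -/
theorem xi_mul_xi (h : P.IsRegularOn W V) (hx : x ∈ W) : P.xi x * P.xi x = 0 := by
  have h1 : P.xi x * P.xi x = -(P.xi x * P.xi x) := by
    rw [← h.sum_rowDII_mul_vecII hx, Finset.sum_mul_sum, ← Finset.sum_neg_distrib]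
    conv_lhs => rw [Finset.sum_comm]
    refine Finset.sum_congr rfl fun k _ => ?_
    rw [← Finset.sum_neg_distrib]
    refine Finset.sum_congr rfl fun l _ => ?_
    have hk := Subalgebra.mem_center_iff.1 (h.rowDII_mem_center hx () k)
    have hl := Subalgebra.mem_center_iff.1 (h.rowDII_mem_center hx () l)
    calc P.rowDII x () l * P.vecII x l * (P.rowDII x () k * P.vecII x k)
        = P.rowDII x () l * P.rowDII x () k * (P.vecII x l * P.vecII x k) := by
          rw [mul_assoc, ← mul_assoc (P.vecII x l), hk (P.vecII x l)]; simp only [mul_assoc]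
      _ = -(P.rowDII x () k * P.rowDII x () l * (P.vecII x k * P.vecII x l)) := by
          rw [mul_eq_neg_mul_of_mem_range (P.vecII_mem x l) (P.vecII_mem x k), mul_neg,
            hk (P.rowDII x () l)]
      _ = _ := by
          rw [mul_assoc (P.rowDII x () k) (P.vecII x k), ← mul_assoc (P.vecII x k),
            hl (P.vecII x k)]; simp only [mul_assoc]
  have h2 : (2 : ℂ) • (P.xi x * P.xi x) = 0 := by
    rw [two_smul]; exact add_eq_zero_iff_eq_neg.2 h1
  simpa using h2

theorem xi_mem (h : P.IsRegularOn W V) (hx : x ∈ W) : P.xi x ∈ ⋀[ℂ]^3 (Fin m → ℂ) := by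
  rw [← h.sum_rowDII_mul_vecII hx]
  exact sum_mem fun l _ => mul_mem_exteriorPower (p := 2) (q := 1) (h.rowDII_mem_sq hx () l)
    (mem_one_of_mem_range (P.vecII_mem x l))

theorem curvature_mul_colII (hp : ∀ y ∈ W, ∀ k, P.curvII y k = 0)
    (hx : x ∈ W) : curvature P.leviCivita x * P.colII x = 0 := by
  ext k a
  exact hp x hx k

/-- The covariant derivative of `R II = 0`, where the Bianchi identity removes `d^∇ R`. Permeability
is needed on a whole neighbourhood. -/
theorem curvature_mul_colDII (h : P.IsRegularOn W V)
    (hp : ∀ y ∈ W, ∀ k, P.curvII y k = 0) (hx : x ∈ W) : curvature P.leviCivita x * P.colDII x = 0 := by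
  have h1 := extDMat_mul_of_mem_center h.isOpen_left hx h.matSmoothOn_curvature h.matSmoothOn_colII
    fun i j => mem_center_of_mem_sq (h.curvature_mem_sq hx i j)
  have h0 : extDMat (fun y => curvature P.leviCivita y * P.colII y) x = 0 := by
    rw [extDMat_congr (B := fun _ => 0) h.isOpen_left hx fun y hy => curvature_mul_colII hp hy]
    ext a b
    simpa [extDMat] using extD_zero
  rw [h0, h.extDMat_curvature hx, extDMat_colII, Matrix.sub_mul, Matrix.mul_sub, Matrix.mul_assoc,
    Matrix.mul_assoc, curvature_mul_colII hp hx, Matrix.mul_zero] at h1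
  rw [h1]
  abel

/-- Leibniz rule for `ξ = c v`: the term `(d^∇ c) v = -b R v` vanishes by permeability, leaving `c
w`. -/
theorem extD_xi (h : P.IsRegularOn W V)
    (hp : ∀ y ∈ W, ∀ k, P.curvII y k = 0) (hx : x ∈ W) : extD P.xi x = (P.rowDII x * P.colDII x) () () := by
  have h1 := extDMat_mul_of_mem_center h.isOpen_left hx h.matSmoothOn_rowDII h.matSmoothOn_colII
    fun i j => h.rowDII_mem_center hx i j
  rw [h.extDMat_rowDII hx, extDMat_colII, Matrix.sub_mul, Matrix.mul_sub, Matrix.mul_assoc,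
    Matrix.mul_assoc, curvature_mul_colII hp hx, Matrix.mul_zero, sub_zero, add_sub_cancel] at h1
  rw [extD_congr_of_isOpen h.isOpen_left hx fun y hy => h.xi_eq_mul hy, ← h1]
  rfl

theorem extD_xi_mem (h : P.IsRegularOn W V)
    (hp : ∀ y ∈ W, ∀ k, P.curvII y k = 0) (hx : x ∈ W) : extD P.xi x ∈ ⋀[ℂ]^4 (Fin m → ℂ) := by
  rw [extD_xi h hp hx, Matrix.mul_apply]
  exact sum_mem fun l _ => mul_mem_exteriorPower (p := 2) (q := 2) (h.rowDII_mem_sq hx () l)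
    (h.dII_mem_sq hx l)

theorem extD_xi_mem_center (h : P.IsRegularOn W V)
    (hp : ∀ y ∈ W, ∀ k, P.curvII y k = 0) (hx : x ∈ W) : extD P.xi x ∈ Subalgebra.center ℂ (Forms m) := by
  rw [extD_xi h hp hx, Matrix.mul_apply]
  exact sum_mem fun l _ => mul_mem (h.rowDII_mem_center hx () l) (h.dII_mem_center hx l)

theorem extD_extD_xi_pow (h : P.IsRegularOn W V)
    (hp : ∀ y ∈ W, ∀ k, P.curvII y k = 0) (hx : x ∈ W) (k : ℕ) : extD (fun y => extD P.xi y ^ k) x = 0 := by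
  have hs := h.formSmoothOn_xi.extD h.isOpen_left
  induction k with
  | zero => simp [extD_eq_sum, formPd_const]
  | succ k ih =>
    simp only [pow_succ]
    rw [extD_mul_of_mem_center h.isOpen_left hx (hs.pow k) hs
      (pow_mem (extD_xi_mem_center h hp hx) k), ih, extD_extD h.isOpen_left hx h.formSmoothOn_xi]
    simp

theorem extD_xi_mul_pow (h : P.IsRegularOn W V)
    (hp : ∀ y ∈ W, ∀ k, P.curvII y k = 0) (hx : x ∈ W) (k : ℕ) :
    extD (fun y => P.xi y * extD P.xi y ^ k) x = extD P.xi x ^ (k + 1) := by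
  have hs := h.formSmoothOn_xi.extD h.isOpen_left
  rw [extD_congr_of_isOpen (θ := fun y => extD P.xi y ^ k * P.xi y) h.isOpen_left hx fun y hy =>
    Subalgebra.mem_center_iff.1 (pow_mem (extD_xi_mem_center h hp hy) k) _,
    extD_mul_of_mem_center h.isOpen_left hx (hs.pow k) h.formSmoothOn_xi
      (pow_mem (extD_xi_mem_center h hp hx) k), extD_extD_xi_pow h hp hx, zero_mul, zero_add,
    pow_succ]

/-! ### The curvature of the interpolated connection -/

/-- Blockwise evaluation of `dA + A ∧ A`: the off-diagonal blocks assemble to `d^∇` of `II`, and the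
normal block is `-t² b v = 0`. -/
theorem curvature_nablaT (h : P.IsRegularOn W V) (hx : x ∈ W) (t : ℝ) :
    curvature (P.nablaT t) x = curvBlock (curvature P.leviCivita x) (P.vecII x) (P.covecII x)
      (P.dII x) (P.rowDII x ()) t := by
  have hv : ∀ i, extD (fun y => P.vecII y i) x =
      P.dII x i - ∑ j, P.leviCivita x i j * P.vecII x j := fun i =>
    congrFun (congrFun (extDMat_colII (P := P) x) i) ()
  have hb : ∀ j, extD (fun y => P.covecII y j) x =
      P.rowDII x () j - ∑ i, P.covecII x i * P.leviCivita x i j := fun j =>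
    congrFun (congrFun (extDMat_rowII (P := P) x) ()) j
  have sv : ∀ i, FormSmoothOn (fun y => P.vecII y i) W := fun i => h.matSmoothOn_colII i ()
  have sb : ∀ i, FormSmoothOn (fun y => P.covecII y i) W := fun i => h.matSmoothOn_rowII () i
  have h0 := h.sum_covecII_mul_vecII hx
  ext (i | i) (j | j)
  · have e : (fun y => P.nablaT t y (Sum.inl i) (Sum.inl j)) = fun y => P.leviCivita y i j := by
      ext y; simp [-Complex.coe_smul, nablaT, nabla, wedgeN]
    simp only [curvature, Matrix.add_apply, Matrix.of_apply, e, curvBlock, Matrix.fromBlocks_apply₁₁,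
      Matrix.mul_apply, Fintype.sum_sum_type]
    simp [-Complex.coe_smul, nablaT, nabla, wedgeN, smul_smul, pow_two, sub_eq_add_neg, add_assoc]
  · have e : (fun y => P.nablaT t y (Sum.inl i) (Sum.inr j)) = fun y => -((t : ℂ) • P.vecII y i) := by
      ext y; simp [-Complex.coe_smul, nablaT, nabla, wedgeN]
    simp only [curvature, Matrix.add_apply, Matrix.of_apply, e, curvBlock, Matrix.fromBlocks_apply₁₂,
      Matrix.mul_apply, Fintype.sum_sum_type]
    rw [extD_neg h.isOpen_left hx ((sv i).const_smul _), extD_const_smul h.isOpen_left hx (sv i), hv]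
    simp [-Complex.coe_smul, nablaT, nabla, wedgeN, smul_sub, Finset.smul_sum]
    abel
  · have e : (fun y => P.nablaT t y (Sum.inr i) (Sum.inl j)) = fun y => (t : ℂ) • P.covecII y j := by
      ext y; simp [-Complex.coe_smul, nablaT, nabla, wedgeN]
    simp only [curvature, Matrix.add_apply, Matrix.of_apply, e, curvBlock, Matrix.fromBlocks_apply₂₁,
      Matrix.mul_apply, Fintype.sum_sum_type]
    rw [extD_const_smul h.isOpen_left hx (sb j), hb]
    simp [-Complex.coe_smul, nablaT, nabla, wedgeN, smul_sub, Finset.smul_sum]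
  · have e : (fun y => P.nablaT t y (Sum.inr i) (Sum.inr j)) = fun y => 0 := by
      ext y; simp [-Complex.coe_smul, nablaT, nabla, wedgeN]
    simp only [curvature, Matrix.add_apply, Matrix.of_apply, e, curvBlock, Matrix.fromBlocks_apply₂₂,
      Matrix.mul_apply, Fintype.sum_sum_type, extD_zero]
    simp [-Complex.coe_smul, nablaT, nabla, wedgeN, ← Finset.smul_sum, h0]

theorem trace_wedgeN_mul_curvature_pow (h : P.IsRegularOn W V)
    (hp : ∀ y ∈ W, ∀ k, P.curvII y k = 0) (hx : x ∈ W) (t : ℝ) (k : ℕ) :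
    (P.wedgeN x * curvature (P.nablaT t) x ^ (2 * k + 1)).trace =
      -(2 * (t : ℂ)) • (P.xi x * (-(t : ℂ) ^ 2 • extD P.xi x) ^ k) := by
  rw [curvature_nablaT h hx]
  refine trace_velBlock_mul_curvBlock_pow (fun i j => mem_center_of_mem_sq (h.curvature_mem_sq hx i j))
    (h.dII_mem_center hx) (h.rowDII_mem_center hx ())
    (fun i j => mem_center_of_mem_sq (mul_mem_sq (P.vecII_mem x i) (P.covecII_mem x j)))
    (fun i => hp x hx i) (fun i => ?_) (h.sum_covecII_mul_vecII hx) (h.sum_covecII_mul_dII hx)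
    (h.sum_rowDII_mul_vecII hx) (extD_xi h hp hx).symm (h.xi_mul_xi hx) k
  exact congrFun (congrFun (curvature_mul_colDII h hp hx) i) ()

end IsRegularOn
end Patch

/-! ### Logarithm and exponential of even power series, evaluated at nilpotents -/

section PowerSeriesFacts

open PowerSeries

/-- `L ^ j` is divisible by `X ^ j`, so only `j ≤ n` contributes to the coefficient. -/
theorem coeff_subst_eq_sum {f L : PowerSeries ℂ} (hL : constantCoeff L = 0) {n N : ℕ}
    (hn : n ≤ N) : coeff n (f.subst L) =
      ∑ j ∈ Finset.range (N + 1), coeff j f * coeff n (L ^ j) := by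
  rw [coeff_subst' (HasSubst.of_constantCoeff_zero' hL)]
  refine finsum_eq_sum_of_support_subset _ fun j hj => ?_
  by_contra h
  refine hj ?_
  have h1 : n < j := by
    simp only [Finset.coe_range, Set.mem_Iio, not_lt] at h
    omega
  have h2 : (X : PowerSeries ℂ) ^ j ∣ L ^ j := pow_dvd_pow_of_dvd (X_dvd_iff.2 hL) j
  simp [X_pow_dvd_iff.1 h2 n h1]

/-- The logarithmic derivative of a power series. -/
theorem mul_derivative_logOf {F : PowerSeries ℂ} (hF : constantCoeff F = 1) :
    F * d⁄dX ℂ (logOf F) = d⁄dX ℂ F := by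
  have hs : HasSubst (F - 1) := HasSubst.of_constantCoeff_zero' (by simp [hF])
  have h1 : (1 + X : PowerSeries ℂ) * d⁄dX ℂ (log ℂ) = 1 := by
    rw [deriv_log]
    ext n
    cases n with
    | zero => simp
    | succ n => rw [add_mul, one_mul, map_add, coeff_succ_X_mul]; simp [pow_succ]
  have h2 := congrArg (subst (F - 1)) h1
  rw [subst_mul hs, subst_add hs, subst_X hs, ← coe_substAlgHom hs, map_one,
    coe_substAlgHom hs, add_sub_cancel] at h2
  rw [logOf_eq, derivative_subst hs, map_sub, ← mul_assoc, h2]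
  simp

/-- The power series `∑ₖ F₂ₖ zᵏ`. -/
def evenPart (F : PowerSeries ℂ) : PowerSeries ℂ := mk fun n => coeff (2 * n) F

/-- The equation `F · (log F)' = F'` in the variable `z²`: compare coefficients at `2n + 1`, where
the odd coefficients of `F` drop out. The common factor `2` comes from differentiating `z²`. -/
theorem evenPart_mul_derivative_evenPart_logOf {F : PowerSeries ℂ} (hF : IsEvenUnitSeries F) :
    evenPart F * d⁄dX ℂ (evenPart (logOf F)) = d⁄dX ℂ (evenPart F) := by
  ext n
  have h := congrArg (coeff (2 * n + 1)) (mul_derivative_logOf hF.1)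
  simp only [coeff_mul, coeff_derivative, evenPart, coeff_mk] at h ⊢
  have h1 : ∑ p ∈ Finset.HasAntidiagonal.antidiagonal n,
      coeff (2 * p.1) F * (coeff (2 * p.2 + 1 + 1) (logOf F) * ((2 * p.2 + 1 : ℕ) + 1)) =
      ∑ p ∈ Finset.HasAntidiagonal.antidiagonal (2 * n + 1),
        coeff p.1 F * (coeff (p.2 + 1) (logOf F) * ((p.2 : ℂ) + 1)) := by
    refine Finset.sum_of_injOn (fun p => (2 * p.1, 2 * p.2 + 1)) ?_ ?_ ?_ ?_
    · rintro ⟨a, b⟩ _ ⟨a', b'⟩ _ h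
      simp only [Prod.mk.injEq] at h ⊢
      omega
    · rintro ⟨a, b⟩ h
      simp only [Finset.mem_coe, Finset.HasAntidiagonal.mem_antidiagonal] at h ⊢
      omega
    · rintro ⟨a, b⟩ hab hne
      rcases Nat.even_or_odd a with ⟨c, hc⟩ | ho
      · exfalso
        refine hne ⟨(c, n - c), ?_, ?_⟩
        · simp only [Finset.mem_coe, Finset.HasAntidiagonal.mem_antidiagonal] at hab ⊢
          omega
        · simp only [Finset.HasAntidiagonal.mem_antidiagonal, Prod.mk.injEq] at hab ⊢
          omega
      · simp [hF.2 a ho]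
    · rintro ⟨a, b⟩ _
      simp
  rw [← h1] at h
  have h2 : (2 : ℂ) ≠ 0 := two_ne_zero
  refine mul_left_cancel₀ h2 ?_
  rw [Finset.mul_sum]
  have e : 2 * (n + 1) = 2 * n + 1 + 1 := by ring
  rw [e]
  calc _ = _ := Finset.sum_congr rfl fun p _ => ?_
    _ = _ := h
    _ = _ := by push_cast; ring
  rw [show 2 * (p.2 + 1) = 2 * p.2 + 1 + 1 by ring]
  push_cast
  ring

theorem constantCoeff_evenPart (F : PowerSeries ℂ) :
    constantCoeff (evenPart F) = constantCoeff F := by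
  rw [← coeff_zero_eq_constantCoeff_apply, ← coeff_zero_eq_constantCoeff_apply, evenPart, coeff_mk]

/-- Both sides solve the same linear differential equation with constant term `1`: their quotient
has derivative zero. -/
theorem exp_subst_evenPart_logOf {F : PowerSeries ℂ} (hF : IsEvenUnitSeries F) :
    (exp ℂ).subst (evenPart (logOf F)) = evenPart F := by
  have hL : constantCoeff (evenPart (logOf F)) = 0 := by
    rw [constantCoeff_evenPart, constantCoeff_logOf hF.1]
  have hH : constantCoeff (evenPart F) = 1 := by rw [constantCoeff_evenPart, hF.1]
  have hE : constantCoeff ((exp ℂ).subst (evenPart (logOf F))) = 1 := by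
    rw [← coeff_zero_eq_constantCoeff_apply, coeff_subst_eq_sum hL le_rfl]
    simp
  have hH0 : constantCoeff (evenPart F) ≠ 0 := by rw [hH]; exact one_ne_zero
  have hmul : (evenPart F)⁻¹ * evenPart F = 1 := PowerSeries.inv_mul_cancel _ hH0
  have key : (exp ℂ).subst (evenPart (logOf F)) * (evenPart F)⁻¹ = 1 := by
    refine derivative.ext ?_ ?_
    · rw [Derivation.leibniz, derivative_subst (HasSubst.of_constantCoeff_zero' hL), derivative_exp,
        derivative_inv', ← evenPart_mul_derivative_evenPart_logOf hF]
      simp only [smul_eq_mul, Derivation.map_one_eq_zero]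
      linear_combination (-(exp ℂ).subst (evenPart (logOf F)) * (evenPart F)⁻¹ *
        d⁄dX ℂ (evenPart (logOf F))) * hmul
    · rw [map_mul, hE, constantCoeff_inv, hH]; simp
  calc _ = (exp ℂ).subst (evenPart (logOf F)) * ((evenPart F)⁻¹ * evenPart F) := by
        rw [hmul, mul_one]
    _ = _ := by rw [← mul_assoc, key, one_mul]

variable {A : Type*} [Ring A] [Algebra ℂ A] {s : A} {m : ℕ}

theorem aeval_trunc (p : PowerSeries ℂ) :
    Polynomial.aeval s (trunc (m + 1) p) = ∑ k ∈ Finset.range (m + 1), coeff k p • s ^ k := by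
  rw [Polynomial.aeval_eq_sum_range' (n := m + 1) (natDegree_trunc_lt p m)]
  refine Finset.sum_congr rfl fun k hk => ?_
  rw [coeff_trunc, if_pos (Finset.mem_range.1 hk)]

/-- Truncation changes a polynomial by a multiple of `X ^ (m + 1)`, which vanishes at `s`. Hence
evaluating truncations respects powers. -/
theorem aeval_trunc_coe (hs : s ^ (m + 1) = 0) (q : Polynomial ℂ) :
    Polynomial.aeval s (trunc (m + 1) (q : PowerSeries ℂ)) = Polynomial.aeval s q := by
  have h : (Polynomial.X : Polynomial ℂ) ^ (m + 1) ∣ q - trunc (m + 1) (q : PowerSeries ℂ) := by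
    rw [Polynomial.X_pow_dvd_iff]
    intro d hd
    rw [Polynomial.coeff_sub, coeff_trunc, if_pos hd, Polynomial.coeff_coe, sub_self]
  obtain ⟨r, hr⟩ := h
  have h2 := congrArg (Polynomial.aeval s) hr
  rw [map_sub, map_mul, map_pow, Polynomial.aeval_X, hs, zero_mul, sub_eq_zero] at h2
  exact h2.symm

theorem aeval_trunc_pow (hs : s ^ (m + 1) = 0) (p : PowerSeries ℂ) (j : ℕ) :
    Polynomial.aeval s (trunc (m + 1) (p ^ j)) =
      Polynomial.aeval s (trunc (m + 1) p) ^ j := by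
  rw [← trunc_trunc_pow, ← Polynomial.coe_pow, aeval_trunc_coe hs, map_pow]

/-- `exp (log F (√s)) = F (√s)` for nilpotent `s`. -/
theorem sum_exp_log {F : PowerSeries ℂ} (hF : IsEvenUnitSeries F) (hs : s ^ (m + 1) = 0) :
    ∑ j ∈ Finset.range (m + 1), coeff j (exp ℂ) •
      (∑ k ∈ Finset.range m, coeff (2 * (k + 1)) (logOf F) • s ^ (k + 1)) ^ j =
    ∑ k ∈ Finset.range (m + 1), coeff (2 * k) F • s ^ k := by
  have hL : constantCoeff (evenPart (logOf F)) = 0 := by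
    rw [constantCoeff_evenPart, constantCoeff_logOf hF.1]
  have e1 : ∑ k ∈ Finset.range m, coeff (2 * (k + 1)) (logOf F) • s ^ (k + 1) =
      Polynomial.aeval s (trunc (m + 1) (evenPart (logOf F))) := by
    rw [aeval_trunc, Finset.sum_range_succ', coeff_zero_eq_constantCoeff_apply, hL]
    simp [evenPart]
  have e2 : ∑ k ∈ Finset.range (m + 1), coeff (2 * k) F • s ^ k =
      ∑ k ∈ Finset.range (m + 1), coeff k (evenPart F) • s ^ k := by simp [evenPart]
  rw [e1, e2, ← exp_subst_evenPart_logOf hF]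
  simp only [← aeval_trunc_pow hs]
  simp only [aeval_trunc, Finset.smul_sum, smul_smul]
  rw [Finset.sum_comm]
  refine Finset.sum_congr rfl fun k hk => ?_
  rw [coeff_subst_eq_sum hL (N := m) (by have := Finset.mem_range.1 hk; omega), Finset.sum_smul]

end PowerSeriesFacts

/-! ### Curves of forms: derivative and fundamental theorem of calculus -/

section TimeCalculus

variable {m : ℕ}

theorem HasTimeDerivAt.timeDeriv_eq {c : ℝ → Forms m} {c' : Forms m} {t : ℝ}
    (h : HasTimeDerivAt c c' t) : timeDeriv c t = c' := by
  rw [timeDeriv, ← sum_formCoeff c']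
  exact Finset.sum_congr rfl fun s _ => by rw [(h s).deriv]

theorem hasTimeDerivAt_sum_smul {α : Type*} {S : Finset α} {q : α → ℝ → ℂ} {q' : α → ℂ}
    {b : α → Forms m} {t : ℝ} (h : ∀ k ∈ S, HasDerivAt (q k) (q' k) t) :
    HasTimeDerivAt (fun τ => ∑ k ∈ S, q k τ • b k) (∑ k ∈ S, q' k • b k) t := fun s => by
  simp only [map_sum, map_smul, smul_eq_mul]
  exact HasDerivAt.fun_sum fun k hk => (h k hk).mul_const _

theorem timeIntegral_eq_sub {C c : ℝ → Forms m} (h : ∀ t, HasTimeDerivAt C (c t) t)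
    (hc : ∀ s, Continuous fun t => formCoeff s (c t)) (a b : ℝ) :
    timeIntegral c a b = C b - C a := by
  rw [← sum_formCoeff (C b - C a), timeIntegral]
  refine Finset.sum_congr rfl fun s _ => ?_
  rw [intervalIntegral.integral_eq_sub_of_hasDerivAt (fun t _ => h t s)
    ((hc s).intervalIntegrable a b), map_sub]

theorem hasDerivAt_ofReal_pow (n : ℕ) (t : ℝ) :
    HasDerivAt (fun τ : ℝ => (τ : ℂ) ^ (n + 1)) ((n + 1 : ℂ) * (t : ℂ) ^ n) t := by
  have h := (hasDerivAt_pow (n + 1) (t : ℂ)).comp_ofReal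
  simpa using h

end TimeCalculus

/-! ### Transgression forms of the linear interpolation -/

namespace Patch

variable {m : ℕ} {P : Patch m} {W : Set (Coord m)} {V : Set (Coord (m + 1))} {x : Coord m}

theorem connVelocity_nablaT (P : Patch m) (t : ℝ) : connVelocity P.nablaT t = P.wedgeN := by
  ext x : 1
  ext a b
  change timeDeriv (fun τ => P.nablaT τ x a b) t = _
  refine HasTimeDerivAt.timeDeriv_eq fun s => ?_
  have h1 : ∀ τ : ℝ, formCoeff s (P.nablaT τ x a b) =
      formCoeff s (P.nabla x a b) + (τ : ℂ) * formCoeff s (P.wedgeN x a b) := by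
    intro τ
    simp [-Complex.coe_smul, nablaT]
  simp only [h1]
  have h2 := ((hasDerivAt_ofReal_pow 0 t).mul_const (formCoeff s (P.wedgeN x a b))).const_add
    (formCoeff s (P.nabla x a b))
  simpa using h2

namespace IsRegularOn

theorem logTransgression_eq (h : P.IsRegularOn W V) (hp : ∀ y ∈ W, ∀ k, P.curvII y k = 0)
    (F : PowerSeries ℂ) (hx : x ∈ W) (t : ℝ) :
    logTransgression F (P.nablaT t) P.wedgeN x = ∑ k ∈ Finset.range m,
      (PowerSeries.coeff (2 * (k + 1)) (PowerSeries.logOf F) / (4 * (Real.pi : ℂ) ^ 2) ^ (k + 1) *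
        ((2 * k + 1 : ℕ) + 1) * (t : ℂ) ^ (2 * k + 1)) • (P.xi x * extD P.xi x ^ k) := by
  -- In the summand with index `k + 1` there are `2(k + 1)` factors `1/(2πi)`. Their sign
  -- `(-1)^(k+1)` cancels the sign `-(-1)^k` of the trace.
  have hc : ((2 * (Real.pi : ℂ) * Complex.I)⁻¹) ^ 2 = -(4 * (Real.pi : ℂ) ^ 2)⁻¹ := by
    rw [inv_pow, mul_pow, mul_pow, Complex.I_sq, ← inv_neg]
    ring_nf
  rw [logTransgression, show Finset.Icc 1 m = Finset.Ico 1 (m + 1) from by ext; simp,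
    Finset.sum_Ico_eq_sum_range]
  refine Finset.sum_congr (by simp) fun k _ => ?_
  rw [show 2 * (1 + k) - 1 = 2 * k + 1 by omega, smul_pow, smul_mul_smul_comm, Matrix.trace_smul,
    trace_wedgeN_mul_curvature_pow h hp hx, ← pow_succ', smul_pow, mul_smul_comm, smul_smul,
    smul_smul, smul_smul, show 2 * k + 1 + 1 = 2 * (k + 1) by ring, pow_mul, hc, add_comm 1 k]
  congr 1
  have h1 : ((-1 : ℂ) ^ k) * (-1) ^ k = 1 := by rw [← mul_pow]; simp
  rw [neg_pow (4 * (Real.pi : ℂ) ^ 2)⁻¹, neg_pow ((t : ℂ) ^ 2), inv_pow, pow_succ (-1 : ℂ) k]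
  push_cast
  linear_combination ((PowerSeries.coeff (2 * (k + 1)) (PowerSeries.logOf F)) /
    (4 * (Real.pi : ℂ) ^ 2) ^ (k + 1) * (2 * k + 2) * (t : ℂ) ^ (2 * k + 1)) * h1

/-- The degree `3 + 4m` exceeds `m`. This removes the last summand of `evalSqrt (LF F)`, whose range
is one longer than that of the transgression form. -/
theorem mul_pow_eq_zero (h : P.IsRegularOn W V) (hp : ∀ y ∈ W, ∀ k, P.curvII y k = 0)
    (hx : x ∈ W) : P.xi x * extD P.xi x ^ m = 0 :=
  eq_zero_of_mem_exteriorPower (n := 3 + 4 * m) (by omega)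
    (mul_mem_exteriorPower (h.xi_mem hx) (pow_mem_exteriorPower (extD_xi_mem h hp hx) m))

theorem extD_xi_pow_eq_zero (h : P.IsRegularOn W V) (hp : ∀ y ∈ W, ∀ k, P.curvII y k = 0)
    (hx : x ∈ W) : extD P.xi x ^ (m + 1) = 0 :=
  eq_zero_of_mem_exteriorPower (n := 4 * (m + 1)) (by omega)
    (pow_mem_exteriorPower (extD_xi_mem h hp hx) (m + 1))

theorem mul_evalSqrt_LF_eq (h : P.IsRegularOn W V) (hp : ∀ y ∈ W, ∀ k, P.curvII y k = 0)
    (F : PowerSeries ℂ) (hx : x ∈ W) (t : ℝ) :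
    (((t : ℂ) ^ 2 / (4 * (Real.pi : ℂ) ^ 2)) • P.xi x) *
      evalSqrt (LF F) (((t : ℂ) ^ 2 / (4 * (Real.pi : ℂ) ^ 2)) • extD P.xi x) =
    ∑ k ∈ Finset.range m,
      (PowerSeries.coeff (2 * (k + 1)) (PowerSeries.logOf F) / (4 * (Real.pi : ℂ) ^ 2) ^ (k + 1) *
        (t : ℂ) ^ (2 * k + 1 + 1)) • (P.xi x * extD P.xi x ^ k) := by
  rw [evalSqrt, Finset.mul_sum, Finset.sum_range_succ]
  simp only [smul_pow, mul_smul_comm, smul_mul_assoc, mul_pow_eq_zero h hp hx, smul_zero, add_zero]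
  refine Finset.sum_congr rfl fun k _ => ?_
  rw [smul_smul, smul_smul, LF, PowerSeries.coeff_mk]
  congr 1
  rw [show 2 * (k + 1) = 2 * k + 2 by ring, div_pow]
  ring

theorem hasTimeDerivAt_mul_evalSqrt_LF (h : P.IsRegularOn W V)
    (hp : ∀ y ∈ W, ∀ k, P.curvII y k = 0) (F : PowerSeries ℂ) (hx : x ∈ W) (t : ℝ) :
    HasTimeDerivAt (fun τ : ℝ => (((τ : ℂ) ^ 2 / (4 * (Real.pi : ℂ) ^ 2)) • P.xi x) *
      evalSqrt (LF F) (((τ : ℂ) ^ 2 / (4 * (Real.pi : ℂ) ^ 2)) • extD P.xi x))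
      (logTransgression F (P.nablaT t) P.wedgeN x) t := by
  rw [logTransgression_eq h hp F hx]
  simp only [mul_evalSqrt_LF_eq h hp F hx, mul_assoc]
  exact hasTimeDerivAt_sum_smul fun k _ => ((hasDerivAt_ofReal_pow (2 * k + 1) t).const_mul
    (1 / (4 * (Real.pi : ℂ) ^ 2) ^ (k + 1))).const_mul _ |> fun h => by
      simpa [div_eq_mul_inv, mul_assoc] using h

/-- The explicit formula is used on all of `W`, not only at `x`, since it is differentiated; then
`d(ξ (dξ)^k) = (dξ)^(k+1)`. -/
theorem extD_logTransgression (h : P.IsRegularOn W V) (hp : ∀ y ∈ W, ∀ k, P.curvII y k = 0)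
    (F : PowerSeries ℂ) (hx : x ∈ W) (t : ℝ) :
    extD (logTransgression F (P.nablaT t) P.wedgeN) x = ∑ k ∈ Finset.range m,
      (PowerSeries.coeff (2 * (k + 1)) (PowerSeries.logOf F) / (4 * (Real.pi : ℂ) ^ 2) ^ (k + 1) *
        ((2 * k + 1 : ℕ) + 1) * (t : ℂ) ^ (2 * k + 1)) • extD P.xi x ^ (k + 1) := by
  have hs : ∀ k, FormSmoothOn (fun y => P.xi y * extD P.xi y ^ k) W := fun k =>
    h.formSmoothOn_xi.mul ((h.formSmoothOn_xi.extD h.isOpen_left).pow k)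
  rw [extD_congr_of_isOpen h.isOpen_left hx fun y hy => logTransgression_eq h hp F hy t,
    extD_sum h.isOpen_left hx fun k _ => (hs k).const_smul _]
  refine Finset.sum_congr rfl fun k _ => ?_
  rw [extD_const_smul h.isOpen_left hx (hs k), extD_xi_mul_pow h hp hx]

/-- The right side is `log F(√(t² dξ / 4π²))`; the polynomial antiderivative in `t` has no constant
term, so it vanishes at `0`. -/
theorem timeIntegral_extD_logTransgression (h : P.IsRegularOn W V)
    (hp : ∀ y ∈ W, ∀ k, P.curvII y k = 0) (F : PowerSeries ℂ) (hx : x ∈ W) (t : ℝ) :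
    timeIntegral (fun τ => extD (logTransgression F (P.nablaT τ) P.wedgeN) x) 0 t =
      ∑ k ∈ Finset.range m, PowerSeries.coeff (2 * (k + 1)) (PowerSeries.logOf F) •
        (((t : ℂ) ^ 2 / (4 * (Real.pi : ℂ) ^ 2)) • extD P.xi x) ^ (k + 1) := by
  simp only [extD_logTransgression h hp F hx]
  have hd : ∀ t : ℝ, HasTimeDerivAt (fun τ : ℝ => ∑ k ∈ Finset.range m,
      (PowerSeries.coeff (2 * (k + 1)) (PowerSeries.logOf F) / (4 * (Real.pi : ℂ) ^ 2) ^ (k + 1) *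
        (τ : ℂ) ^ (2 * k + 1 + 1)) • extD P.xi x ^ (k + 1))
      (∑ k ∈ Finset.range m,
      (PowerSeries.coeff (2 * (k + 1)) (PowerSeries.logOf F) / (4 * (Real.pi : ℂ) ^ 2) ^ (k + 1) *
        ((2 * k + 1 : ℕ) + 1) * (t : ℂ) ^ (2 * k + 1)) • extD P.xi x ^ (k + 1)) t := by
    intro t
    simp only [mul_assoc]
    exact hasTimeDerivAt_sum_smul fun k _ => (hasDerivAt_ofReal_pow (2 * k + 1) t).const_mul _
  rw [timeIntegral_eq_sub hd]
  · simp only [smul_pow, smul_smul]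
    rw [sub_eq_self.2]
    · refine Finset.sum_congr rfl fun k _ => ?_
      congr 1
      rw [div_pow]
      ring
    · simp
  · intro s
    simp only [map_sum, map_smul, smul_eq_mul]
    fun_prop

theorem transgression_nablaT (h : P.IsRegularOn W V)
    (hp : ∀ y ∈ W, ∀ k, P.curvII y k = 0) {F : PowerSeries ℂ} (hF : IsEvenUnitSeries F)
    (hx : x ∈ W) :
    transgression F P.nablaT x = timeIntegral (fun t : ℝ =>
      evalSqrt F (((t : ℂ) ^ 2 / (4 * (Real.pi : ℂ) ^ 2)) • extD P.xi x) *
        logTransgression F (P.nablaT t) P.wedgeN x) 0 1 := by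
  rw [transgression]
  congr 1
  ext t
  simp only [connVelocity_nablaT]
  rw [timeIntegral_extD_logTransgression h hp F hx, evalSeries, evalSqrt, sum_exp_log hF]
  rw [smul_pow, extD_xi_pow_eq_zero h hp hx, smul_zero]

end IsRegularOn
end Patch

end PermeableHypersurface

end

/-! ### The main theorem, assembled from the local results -/

theorem mainTheorem4 {m : ℕ}
    {M : Type*} [TopologicalSpace M] [ChartedSpace (EuclideanSpace ℝ (Fin m)) M]
    [IsManifold (𝓡 m) ∞ M]
    {M' : Type*} [TopologicalSpace M'] [ChartedSpace (EuclideanSpace ℝ (Fin (m + 1))) M']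
    [IsManifold (𝓡 (m + 1)) ∞ M']
    (g : Bundle.ContMDiffRiemannianMetric (𝓡 (m + 1)) ∞ (EuclideanSpace ℝ (Fin (m + 1)))
      (fun q : M' => TangentSpace (𝓡 (m + 1)) q))
    (ι : M → M') (hι : PermeableHypersurface.IsHypersurface (m := m) ι)
    (hperm : PermeableHypersurface.IsPermeable (m := m) g ι)
    (F : PowerSeries ℂ) (hF : PermeableHypersurface.IsEvenUnitSeries F)
    (U : Set M) (hU : IsOpen U) (N : ∀ p : M, TangentSpace (𝓡 (m + 1)) (ι p))
    (hN : PermeableHypersurface.IsUnitNormal g ι U N)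
    (φ : OpenPartialHomeomorph M (EuclideanSpace ℝ (Fin m)))
    (hφ : φ ∈ IsManifold.maximalAtlas (𝓡 m) ∞ M)
    (ψ : OpenPartialHomeomorph M' (EuclideanSpace ℝ (Fin (m + 1))))
    (hψ : ψ ∈ IsManifold.maximalAtlas (𝓡 (m + 1)) ∞ M')
    (P : PermeableHypersurface.Patch m) (hP : P = PermeableHypersurface.patch g ι N φ ψ)
    (x : EuclideanSpace ℝ (Fin m)) (hx : x ∈ PermeableHypersurface.patchDomain ι U φ ψ) :
    P.IsOuterConnectionMatrix (P.nablaT 1 x) x ∧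
    (∀ t : ℝ, PermeableHypersurface.HasTimeDerivAt
      (fun τ : ℝ => (((τ : ℂ) ^ 2 / (4 * (Real.pi : ℂ) ^ 2)) • P.xi x) *
        PermeableHypersurface.evalSqrt (PermeableHypersurface.LF F)
          (((τ : ℂ) ^ 2 / (4 * (Real.pi : ℂ) ^ 2)) • PermeableHypersurface.extD P.xi x))
      (PermeableHypersurface.logTransgression F (P.nablaT t) P.wedgeN x) t) ∧
    PermeableHypersurface.transgression F P.nablaT x =
      PermeableHypersurface.timeIntegral (fun t : ℝ =>
        PermeableHypersurface.evalSqrt F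
          (((t : ℂ) ^ 2 / (4 * (Real.pi : ℂ) ^ 2)) • PermeableHypersurface.extD P.xi x) *
        PermeableHypersurface.timeDeriv
          (fun τ : ℝ => (((τ : ℂ) ^ 2 / (4 * (Real.pi : ℂ) ^ 2)) • P.xi x) *
            PermeableHypersurface.evalSqrt (PermeableHypersurface.LF F)
              (((τ : ℂ) ^ 2 / (4 * (Real.pi : ℂ) ^ 2)) • PermeableHypersurface.extD P.xi x)) t)
        0 1 := by
  have hreg : P.IsRegularOn (PermeableHypersurface.patchDomain ι U φ ψ) ψ.target :=
    hP ▸ PermeableHypersurface.patch_isRegularOn g hι hU hN hφ hψ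
  have hp : ∀ y ∈ PermeableHypersurface.patchDomain ι U φ ψ, ∀ k, P.curvII y k = 0 :=
    hP ▸ hperm U N hU hN φ hφ ψ hψ
  have hd := hreg.hasTimeDerivAt_mul_evalSqrt_LF hp F hx
  refine ⟨hreg.isOuterConnectionMatrix hx, hd, ?_⟩
  rw [hreg.transgression_nablaT hp hF hx]
  congr 1
  ext t
  rw [(hd t).timeDeriv_eq]
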